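/- Let $(M,g)$ be a smooth finite-dimensional (Hausdorff) Riemannian manifold without boundary, with Levi-Civita connection $\nabla^g$. Let $V$ be a smooth vector field on $M$, and let $\nabla$ be the metric connection with vectorial torsion defined by $V$, $$\nabla_X Y=\nabla^g_X Y+g(X,Y)\,V-g(V,Y)\,X .$$ A $\nabla$-geodesic is a $C^2$ curve $\gamma:J\to M$ on an open set $J\subseteq\mathbb R$ (for instance an open interval) with $\nabla_{\dot\gamma}\dot\gamma=0$, that is, $$\nabla^g_{\dot\gamma}\dot\gamma+g(\dot\gamma,\dot\gamma)\,V-g(V,\dot\gamma)\,\dot\gamma=0 .$$ The first curvature of a curve $\gamma$ at a point where $\dot\gamma\neq 0$ is its Riemannian geodesic curvature $\kappa_\gamma=\|(\nabla^g_{\dot\gamma}\dot\gamma)^{\perp}\|/\|\dot\gamma\|^{2}$, where $\perp$ denotes the component orthogonal to $\dot\gamma$ (so $\kappa_\gamma=\|\nabla^g_{\dot\gamma}\dot\gamma\|/\|\dot\gamma\|^{2}$ if $\gamma$ has constant speed, as every $\nabla$-geodesic has on each interval). Let $X$ be a smooth Killing vector field, i.e. $g(\nabla^g_Y X,Z)+g(\nabla^g_Z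 X,Y)=0$ for all $Y,Z$, which commutes with $V$, i.e. $[X,V]=0$. For $s\in\mathbb R$ let $\Phi_s$ be the time-$s$ map of the (maximal, possibly only local) flow of $X$, defined on the set of all points whose integral curve of $X$ exists up to time $s$. Let $\gamma:J\to M$ be a $\nabla$-geodesic whose image lies in the domain of $\Phi_s$. Then $\gamma^*:=\Phi_s\circ\gamma$ is again a $\nabla$-geodesic. Moreover, at every $t\in J$ with $\dot\gamma(t)\neq0$ one has $\dot\gamma^*(t)\neq 0$, and the first curvatures of $\gamma$ and $\gamma^*$ at $t$ coincide: $\kappa_{\gamma^*}(t)=\kappa_\gamma(t)$. -/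

import Mathlib

open scoped Manifold ContDiff Topology

noncomputable section

namespace VectorialTorsion

/-! `M` is a smooth manifold without boundary modelled on the finite-dimensional real vector space
`E`. Mathlib's tangent space `T_x M` is a copy of `E`, identified through the preferred chart
`extChartAt 𝓘(ℝ, E) x` around `x`; the derivative at `x` of that chart is the identity. -/

variable {E : Type*} [NormedAddCommGroup E] [NormedSpace ℝ E]
  {M : Type*} [TopologicalSpace M] [ChartedSpace E M]

section LeviCivita

variable [IsManifold 𝓘(ℝ, E) ∞ M]

/-- A smooth vector field on `M`. -/
def IsSmoothField (X : (x : M) → TangentSpace 𝓘(ℝ, E) x) : Prop :=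
  ContMDiff 𝓘(ℝ, E) (𝓘(ℝ, E).prod 𝓘(ℝ, E)) ∞
    (fun x => (⟨x, X x⟩ : TangentBundle 𝓘(ℝ, E) M))

/-- A smooth Riemannian metric on `M`. -/
abbrev Metric (E : Type*) [NormedAddCommGroup E] [NormedSpace ℝ E]
    (M : Type*) [TopologicalSpace M] [ChartedSpace E M] [IsManifold 𝓘(ℝ, E) ∞ M] :=
  Bundle.ContMDiffRiemannianMetric 𝓘(ℝ, E) ∞ E (fun x : M => TangentSpace 𝓘(ℝ, E) x)

/-- The derivative of the inverse of the preferred chart around `x`, at the point `p` of `E`. Its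
codomain is the tangent space of `M` at the image of `p`, which is a copy of `E`. -/
def chartInvDeriv (x : M) (p : E) : E →L[ℝ] E :=
  mfderiv 𝓘(ℝ, E) 𝓘(ℝ, E) (extChartAt 𝓘(ℝ, E) x).symm p

/-- The metric in the preferred chart around `x`: the pullback of `g` under the inverse chart,
a bilinear form on `E` depending on the point `p` of the chart domain. -/
def chartMetric (g : Metric E M) (x : M) (p : E) : E →L[ℝ] E →L[ℝ] ℝ :=
  let B : E →L[ℝ] E →L[ℝ] ℝ := g.inner ((extChartAt 𝓘(ℝ, E) x).symm p)
  B.bilinearComp (chartInvDeriv x p) (chartInvDeriv x p)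

/-- The linear form
`w ↦ ½ (∂_u g(v, w) + ∂_v g(u, w) - ∂_w g(u, v))`, for constant vectors `u`, `v`, `w` in the
preferred chart around `x` (the Christoffel symbols of the first kind). -/
def christoffelFirst (g : Metric E M) (x : M) (p u v : E) : E →L[ℝ] ℝ :=
  let D : E →L[ℝ] E →L[ℝ] E →L[ℝ] ℝ := fderiv ℝ (chartMetric g x) p
  (1 / 2 : ℝ) • (D u v + D v u - (D.flip u).flip v)

/-- The Christoffel symbols `Γ(u, v)` of `g` in the preferred chart around `x`, at the point `p` of
the chart domain: the vector with
`g(Γ(u, v), w) = ½ (∂_u g(v, w) + ∂_v g(u, w) - ∂_w g(u, v))` for all `w`. -/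
def christoffel (g : Metric E M) (x : M) (p u v : E) : E :=
  (chartMetric g x p).inverse (christoffelFirst g x p u v)

/-- The Levi-Civita covariant derivative `(∇^g_u Y)(x)` of a vector field `Y` in the direction
`u ∈ T_x M`. In the preferred chart around `x` it is `∂_u Y + Γ(u, Y)`. -/
def leviCivita (g : Metric E M) (Y : (x : M) → TangentSpace 𝓘(ℝ, E) x) (x : M)
    (u : TangentSpace 𝓘(ℝ, E) x) : TangentSpace 𝓘(ℝ, E) x :=
  let Yhat : E → E :=
    VectorField.mpullback 𝓘(ℝ, E) 𝓘(ℝ, E) (extChartAt 𝓘(ℝ, E) x).symm Y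
  fderiv ℝ Yhat (extChartAt 𝓘(ℝ, E) x x) (u : E) +
    christoffel g x (extChartAt 𝓘(ℝ, E) x x) (u : E) (Y x : E)

/-- `X` is a Killing vector field:
`g(∇^g_u X, w) + g(∇^g_w X, u) = 0` for all tangent vectors `u`, `w`. -/
def IsKilling (g : Metric E M) (X : (x : M) → TangentSpace 𝓘(ℝ, E) x) : Prop :=
  ∀ (x : M) (u w : TangentSpace 𝓘(ℝ, E) x),
    g.inner x (leviCivita g X x u) w + g.inner x (leviCivita g X x w) u = 0

end LeviCivita

section Curves

/-- The velocity of a curve. -/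
def velocity (γ : ℝ → M) (t : ℝ) : TangentSpace 𝓘(ℝ, E) (γ t) :=
  mfderiv 𝓘(ℝ, ℝ) 𝓘(ℝ, E) γ t (1 : ℝ)

variable [IsManifold 𝓘(ℝ, E) ∞ M]

/-- The Levi-Civita covariant derivative `∇^g_{γ'} W` of a vector field `W` along the curve `γ`.
In the preferred chart around `γ t` it is `dW/dt + Γ(γ', W)`. -/
def leviCivitaAlong (g : Metric E M) (γ : ℝ → M) (W : (t : ℝ) → TangentSpace 𝓘(ℝ, E) (γ t))
    (t : ℝ) : TangentSpace 𝓘(ℝ, E) (γ t) :=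
  let What : ℝ → E := fun τ =>
    mfderiv 𝓘(ℝ, E) 𝓘(ℝ, E) (extChartAt 𝓘(ℝ, E) (γ t)) (γ τ) (W τ)
  deriv What t +
    christoffel g (γ t) (extChartAt 𝓘(ℝ, E) (γ t) (γ t))
      (velocity (E := E) γ t : E) (W t : E)

/-- The covariant derivative `∇_{γ'} W` of a vector field `W` along `γ`, for the metric connection
with vectorial torsion `∇_X Y = ∇^g_X Y + g(X, Y) V - g(V, Y) X`. -/
def vectorialAlong (g : Metric E M) (V : (x : M) → TangentSpace 𝓘(ℝ, E) x) (γ : ℝ → M)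
    (W : (t : ℝ) → TangentSpace 𝓘(ℝ, E) (γ t)) (t : ℝ) : TangentSpace 𝓘(ℝ, E) (γ t) :=
  leviCivitaAlong g γ W t + g.inner (γ t) (velocity γ t) (W t) • V (γ t) -
    g.inner (γ t) (V (γ t)) (W t) • velocity γ t

/-- The curve `γ`, defined on the open set `J` of parameters (its values elsewhere are irrelevant),
is a `∇`-geodesic: it is `C²` and satisfies `∇_{γ'} γ' = 0`, i.e.
`∇^g_{γ'} γ' + g(γ', γ') V - g(V, γ') γ' = 0`. -/
def IsGeodesicOn (g : Metric E M) (V : (x : M) → TangentSpace 𝓘(ℝ, E) x) (γ : ℝ → M)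
    (J : Set ℝ) : Prop :=
  ContMDiffOn 𝓘(ℝ, ℝ) 𝓘(ℝ, E) 2 γ J ∧
    ∀ t ∈ J, vectorialAlong g V γ (velocity γ) t = 0

/-- The first (Riemannian geodesic) curvature of a curve at a parameter with nonzero velocity: the
length of the component of `∇^g_{γ'} γ'` normal to `γ'`, divided by `g(γ', γ')`. For curves of
constant speed `c`, where `∇^g_{γ'} γ'` is normal to `γ'`, this is `‖∇^g_{γ'} γ'‖ / c²`. -/
def firstCurvature (g : Metric E M) (γ : ℝ → M) (t : ℝ) : ℝ :=
  let v : TangentSpace 𝓘(ℝ, E) (γ t) := velocity γ t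
  let a : TangentSpace 𝓘(ℝ, E) (γ t) := leviCivitaAlong g γ (velocity γ) t
  let n : TangentSpace 𝓘(ℝ, E) (γ t) := a - (g.inner (γ t) a v / g.inner (γ t) v v) • v
  Real.sqrt (g.inner (γ t) n n) / g.inner (γ t) v v

end Curves

section Flow

/-- `FlowsTo X s p q`: the integral curve of `X` starting at `p` is defined up to time `s`
(positive or negative), and its value at time `s` is `q`. -/
def FlowsTo (X : (x : M) → TangentSpace 𝓘(ℝ, E) x) (s : ℝ) (p q : M) : Prop :=
  ∃ (a b : ℝ) (c : ℝ → M), (0 : ℝ) ∈ Set.Ioo a b ∧ s ∈ Set.Ioo a b ∧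
    IsMIntegralCurveOn c X (Set.Ioo a b) ∧ c 0 = p ∧ c s = q

/-- The domain of the time-`s` map `Φ_s` of the flow of `X`. -/
def flowDomain (X : (x : M) → TangentSpace 𝓘(ℝ, E) x) (s : ℝ) : Set M :=
  {p | ∃ q, FlowsTo X s p q}

open Classical in
/-- The time-`s` map `Φ_s` of the (maximal, possibly only local) flow of `X`; its value outside
`flowDomain X s` is irrelevant. -/
def flow (X : (x : M) → TangentSpace 𝓘(ℝ, E) x) (s : ℝ) (p : M) : M :=
  if h : ∃ q, FlowsTo X s p q then h.choose else p

end Flow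

end VectorialTorsion

end

/-! The flow of a Killing field acts by local isometries, and it preserves every field that commutes
with the Killing field. Velocity, Levi-Civita acceleration, `g` and `V` along `γ` are therefore
carried by `dΦ_s` to the corresponding data along the image curve. The left side of the geodesic
equation and the normal part of the acceleration are built only from these, so the first is mapped
linearly and the second keeps its length.

Three inputs carry this. First, `Φ_s` must be `C²` near each point of its domain. Picard–Lindelöf
gives a continuous local flow; applying it to `f` coupled with its linearization gains derivatives
in the initial value, and a connectedness argument along the integral curve reaches time `s`
(`flowRegularAt_of_isMIntegralCurveOn`).

Second, along an integral curve of `X`, both `dΦ_τ u` and `V` satisfy the linearized equation of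
`X`, called Lie transport here. The Killing equation says exactly that the product of two
Lie-transported vectors has derivative zero (`IsKilling.hasDerivAt_innerE`). Two vectors `dΦ_τ u`,
`dΦ_τ w` give the isometry property; `V` paired with `dΦ_τ u` then gives `dΦ_s V = V`.

Third, an isometry respects acceleration: the second derivative of the map in the transformation law
of the Christoffel symbols (`IsIsometricAt.mapDeriv_christoffel`) is the one produced by
differentiating the image curve twice. -/

noncomputable section

namespace VectorialTorsion

/-! ### Differentiable dependence on initial values in a normed space -/

section FlatFlow

open Set Metric

/-- A two-sided Grönwall inequality. -/
theorem norm_le_gronwallBound_abs {F : Type*} [NormedAddCommGroup F] [NormedSpace ℝ F]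
    {e e' : ℝ → F} {δ K η r : ℝ}
    (he : ∀ t ∈ Ioo (-r) r, HasDerivAt e (e' t) t) (h0 : ‖e 0‖ ≤ δ)
    (hb : ∀ t ∈ Ioo (-r) r, ‖e' t‖ ≤ K * ‖e t‖ + η) :
    ∀ t ∈ Ioo (-r) r, ‖e t‖ ≤ gronwallBound δ K η |t| := by
  intro t ht
  rcases le_total 0 t with h | h
  · have hI : ∀ x ∈ Icc 0 t, x ∈ Ioo (-r) r := fun x hx =>
      ⟨by linarith [hx.1, ht.2], hx.2.trans_lt ht.2⟩
    have := norm_le_gronwallBound_of_norm_deriv_right_le (f := e) (f' := e') (δ := δ) (K := K)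
      (ε := η) (a := 0) (b := t)
      (fun x hx => (he x (hI x hx)).continuousAt.continuousWithinAt)
      (fun x hx => (he x (hI x ⟨hx.1, hx.2.le⟩)).hasDerivWithinAt) h0
      (fun x hx => hb x (hI x ⟨hx.1, hx.2.le⟩)) t ⟨h, le_rfl⟩
    simpa [abs_of_nonneg h] using this
  · have hI : ∀ x ∈ Icc 0 (-t), -x ∈ Ioo (-r) r := fun x hx =>
      ⟨by linarith [hx.2, ht.1], by linarith [hx.1, ht.1, ht.2]⟩
    have hd : ∀ x ∈ Icc 0 (-t), HasDerivAt (fun y => e (-y)) (-e' (-x)) x := fun x hx => by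
      simpa [Function.comp_def] using (he (-x) (hI x hx)).scomp x (hasDerivAt_neg x)
    have := norm_le_gronwallBound_of_norm_deriv_right_le (f := fun y => e (-y))
      (f' := fun y => -e' (-y)) (δ := δ) (K := K) (ε := η) (a := 0) (b := -t)
      (fun x hx => (hd x hx).continuousAt.continuousWithinAt)
      (fun x hx => (hd x ⟨hx.1, hx.2.le⟩).hasDerivWithinAt) (by simpa using h0)
      (fun x hx => by simpa using hb (-x) (hI x ⟨hx.1, hx.2.le⟩)) (-t) ⟨by linarith, le_rfl⟩
    simpa [abs_of_nonpos h] using this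

/-- The maps `φ t`, for `|t| < ε`, form a `C^k` local flow of the field `f` on the open set `U`,
with values in `W`. -/
structure IsLocalFlow {F : Type*} [NormedAddCommGroup F] [NormedSpace ℝ F] (f : F → F)
    (k : ℕ) (φ : ℝ → F → F) (ε : ℝ) (U W : Set F) : Prop where
  pos : 0 < ε
  isOpen : IsOpen U
  zero : ∀ x ∈ U, φ 0 x = x
  mem : ∀ x ∈ U, ∀ t ∈ Ioo (-ε) ε, φ t x ∈ W
  hasDerivAt : ∀ x ∈ U, ∀ t ∈ Ioo (-ε) ε, HasDerivAt (fun τ => φ τ x) (f (φ t x)) t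
  contDiffOn : ∀ t ∈ Ioo (-ε) ε, ContDiffOn ℝ k (φ t) U

/-- Picard–Lindelöf with joint continuity in time and initial value: continuity at `(x₀, 0)`
provides a product neighbourhood on which trajectories stay in `W`. -/
theorem exists_isLocalFlow_zero {F : Type*} [NormedAddCommGroup F] [NormedSpace ℝ F]
    [CompleteSpace F] {f : F → F} {x₀ : F} (hf : ContDiffAt ℝ 1 f x₀) {W : Set F}
    (hW : W ∈ 𝓝 x₀) :
    ∃ φ ε U, x₀ ∈ U ∧ IsLocalFlow f 0 φ ε U W := by
  obtain ⟨δ, hδ, a, r, L, K, hr, hpl⟩ := IsPicardLindelof.of_contDiffAt_one hf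
  obtain ⟨α, hα, hc⟩ := (hpl 0).exists_forall_mem_closedBall_eq_hasDerivWithinAt_continuousOn
  have hr' : (0 : ℝ) < r := hr
  have hmem : closedBall x₀ r ×ˢ Icc (0 - δ) (0 + δ) ∈ 𝓝 (x₀, (0 : ℝ)) :=
    prod_mem_nhds (closedBall_mem_nhds _ hr') (Icc_mem_nhds (by linarith) (by linarith))
  have hca := hc.continuousAt hmem
  have hα0 : α (x₀, 0) = x₀ := (hα x₀ (mem_closedBall_self hr'.le)).1
  have hpre : α ⁻¹' W ∈ 𝓝 (x₀, (0 : ℝ)) :=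
    hca (by rwa [hα0])
  obtain ⟨A, hA, B, hB, hAB⟩ := mem_nhds_prod_iff.1 (Filter.inter_mem hpre hmem)
  obtain ⟨ε, hε, hεB⟩ := Metric.mem_nhds_iff.1 (Filter.inter_mem hB
    (Ioo_mem_nhds (show (0 : ℝ) - δ < 0 by linarith) (show (0 : ℝ) < 0 + δ by linarith)))
  have hball : ∀ t ∈ Ioo (-ε) ε, t ∈ B ∩ Ioo (0 - δ) (0 + δ) := fun t ht =>
    hεB (by simpa [Real.ball_eq_Ioo] using ht)
  have hint : interior A ⊆ closedBall x₀ r := fun x hx =>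
    (hAB (mk_mem_prod (interior_subset hx) (mem_of_mem_nhds hB))).2.1
  refine ⟨fun t x => α (x, t), ε, interior A, mem_interior_iff_mem_nhds.2 hA, hε, isOpen_interior,
    fun x hx => (hα x (hint hx)).1, fun x hx t ht =>
      (hAB (mk_mem_prod (interior_subset hx) (hball t ht).1)).1, fun x hx t ht => ?_,
    fun t ht => ?_⟩
  · have h1 := (hball t ht).2
    exact ((hα x (hint hx)).2 t (Ioo_subset_Icc_self h1)).hasDerivAt (Icc_mem_nhds h1.1 h1.2)
  · simp only [Nat.cast_zero, contDiffOn_zero]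
    have : ContinuousOn (fun x : F => (x, t)) (interior A) := by fun_prop
    exact hc.comp this fun x hx => ⟨hint hx, Ioo_subset_Icc_self (hball t ht).2⟩

variable {F : Type*} [NormedAddCommGroup F] [NormedSpace ℝ F]

/-- Solutions of `x' = f x` and of its linearization: the solution of the linearized equation
along a trajectory is the derivative of the flow with respect to the initial value. -/
theorem hasFDerivAt_of_variational {f : F → F} {φ : ℝ → F → F}
    {A : ℝ → F →L[ℝ] F} {ε : ℝ} {U W : Set F} {K : ℝ} {x : F} (hU : U ∈ 𝓝 x)
    (hW : Convex ℝ W) (hfd : ∀ y ∈ W, HasFDerivAt f (fderiv ℝ f y) y)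
    (hK : ∀ y ∈ W, ‖fderiv ℝ f y‖ ≤ K)
    (hC : ∀ y ∈ W, ∀ z ∈ W, ‖fderiv ℝ f y - fderiv ℝ f z‖ ≤ K * ‖y - z‖)
    (h0 : ∀ y ∈ U, φ 0 y = y) (hφW : ∀ y ∈ U, ∀ t ∈ Ioo (-ε) ε, φ t y ∈ W)
    (hφ : ∀ y ∈ U, ∀ t ∈ Ioo (-ε) ε, HasDerivAt (fun τ => φ τ y) (f (φ t y)) t)
    (hA0 : A 0 = ContinuousLinearMap.id ℝ F)
    (hA : ∀ t ∈ Ioo (-ε) ε, HasDerivAt A ((fderiv ℝ f (φ t x)).comp (A t)) t)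
    {t : ℝ} (ht : t ∈ Ioo (-ε) ε) : HasFDerivAt (φ t) (A t) x := by
  have hx := mem_of_mem_nhds hU
  have hK0 : 0 ≤ K := (norm_nonneg _).trans (hK _ (hφW x hx t ht))
  have hlip : ∀ y ∈ U, ∀ τ ∈ Ioo (-ε) ε, ‖φ τ y - φ τ x‖ ≤ ‖y - x‖ * Real.exp (K * ε) := by
    intro y hy τ hτ
    have := norm_le_gronwallBound_abs (e := fun τ => φ τ y - φ τ x)
      (e' := fun τ => f (φ τ y) - f (φ τ x)) (δ := ‖y - x‖) (K := K) (η := 0) (r := ε)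
      (fun τ hτ => (hφ y hy τ hτ).sub (hφ x hx τ hτ)) (by simp [h0 y hy, h0 x hx])
      (fun τ hτ => by
        simpa using hW.norm_image_sub_le_of_norm_hasFDerivWithin_le
          (fun z hz => (hfd z hz).hasFDerivWithinAt) hK (hφW x hx τ hτ) (hφW y hy τ hτ)) τ hτ
    refine this.trans ?_
    rw [gronwallBound_ε0]
    gcongr
    exact (abs_lt.2 ⟨hτ.1, hτ.2⟩).le
  -- Quadratic Taylor remainder: on the segment from `a` to `b` the derivative of `f` differs from
  -- its value at `a` by at most `K * ‖b - a‖`.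
  have hrem : ∀ a ∈ W, ∀ b ∈ W, ‖f b - f a - fderiv ℝ f a (b - a)‖ ≤ K * ‖b - a‖ * ‖b - a‖ := by
    intro a ha b hb
    have hs : segment ℝ a b ⊆ W := hW.segment_subset ha hb
    refine (convex_segment a b).norm_image_sub_le_of_norm_hasFDerivWithin_le'
      (fun z hz => (hfd z (hs hz)).hasFDerivWithinAt) (fun z hz => ?_)
      (left_mem_segment ℝ a b) (right_mem_segment ℝ a b)
    refine (hC z (hs hz) a ha).trans ?_
    gcongr
    obtain ⟨θ, hθ, rfl⟩ := (segment_eq_image' ℝ a b) ▸ hz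
    simp only [add_sub_cancel_left, norm_smul, Real.norm_eq_abs, abs_of_nonneg hθ.1]
    exact mul_le_of_le_one_left (norm_nonneg _) hθ.2
  -- The remainder `hrem` evaluated on the separation of trajectories bounded in `hlip`; this is the
  -- forcing term in the Grönwall estimate below.
  set C := K * Real.exp (K * ε) ^ 2
  have hC0 : 0 ≤ C := by positivity
  have hmain : ∀ y ∈ U, ‖φ t y - φ t x - A t (y - x)‖ ≤
      gronwallBound 0 K C |t| * ‖y - x‖ ^ 2 := by
    intro y hy
    have := norm_le_gronwallBound_abs (e := fun τ => φ τ y - φ τ x - A τ (y - x))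
      (e' := fun τ => f (φ τ y) - f (φ τ x) - (fderiv ℝ f (φ τ x)).comp (A τ) (y - x))
      (δ := 0) (K := K) (η := C * ‖y - x‖ ^ 2) (r := ε)
      (fun τ hτ => ((hφ y hy τ hτ).sub (hφ x hx τ hτ)).sub
        ((hA τ hτ).clm_apply (hasDerivAt_const τ (y - x)) |>.congr_deriv (by simp))) (by simp [h0 y hy, h0 x hx, hA0])
      (fun τ hτ => by
        have e1 : f (φ τ y) - f (φ τ x) - (fderiv ℝ f (φ τ x)).comp (A τ) (y - x) =
          fderiv ℝ f (φ τ x) (φ τ y - φ τ x - A τ (y - x)) +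
            (f (φ τ y) - f (φ τ x) - fderiv ℝ f (φ τ x) (φ τ y - φ τ x)) := by
          simp only [map_sub, ContinuousLinearMap.comp_apply]; abel
        rw [e1]
        refine (norm_add_le _ _).trans (add_le_add ?_ ?_)
        · exact ((fderiv ℝ f (φ τ x)).le_opNorm _).trans
            (mul_le_mul_of_nonneg_right (hK _ (hφW x hx τ hτ)) (norm_nonneg _))
        · refine (hrem _ (hφW x hx τ hτ) _ (hφW y hy τ hτ)).trans ?_
          have := hlip y hy τ hτ
          calc K * ‖φ τ y - φ τ x‖ * ‖φ τ y - φ τ x‖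
              ≤ K * (‖y - x‖ * Real.exp (K * ε)) * (‖y - x‖ * Real.exp (K * ε)) := by gcongr
            _ = C * ‖y - x‖ ^ 2 := by ring) t ht
    refine this.trans (le_of_eq ?_)
    -- With zero initial error the bound is linear in the forcing term, both for `K = 0` and for `K
    -- ≠ 0`, so the factor `‖y - x‖ ^ 2` comes out.
    unfold gronwallBound
    split_ifs
    · ring
    · ring
  rw [hasFDerivAt_iff_isLittleO]
  have hO : (fun y => φ t y - φ t x - A t (y - x)) =O[𝓝 x] fun y => ‖y - x‖ ^ 2 :=
    Asymptotics.IsBigO.of_bound (gronwallBound 0 K C |t|) (by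
      filter_upwards [hU] with y hy
      simpa using hmain y hy)
  refine hO.trans_isLittleO ?_
  have h2 : (fun y : F => ‖y - x‖ ^ 2) = fun y => ‖y - x‖ * ‖y - x‖ := by ext; ring
  rw [h2]
  have h3 : (fun y : F => ‖y - x‖) =o[𝓝 x] fun _ => (1 : ℝ) := by
    rw [Asymptotics.isLittleO_one_iff]
    have : Continuous fun y : F => ‖y - x‖ := by fun_prop
    simpa using this.tendsto x
  have h4 := h3.mul_isBigO (Asymptotics.isBigO_refl (fun y : F => ‖y - x‖) (𝓝 x))
  simp only [one_mul] at h4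
  exact h4.of_norm_right

/-- The induction hypothesis is applied to the coupled system `x' = f x`, `A' = Df(x) ∘ A` on `F ×
(F →L[ℝ] F)`, which costs one derivative of `f`. Started at `(x, id)`, its second component is the
spatial derivative of the first by `hasFDerivAt_of_variational`. It is `C^k`, so the flow is
`C^(k+1)`. -/
theorem exists_isLocalFlow_succ [CompleteSpace F] {f : F → F} {x₀ : F} {k : ℕ}
    (hf : ContDiffAt ℝ (k + 2 : ℕ) f x₀)
    (ih : ∀ {g : F × (F →L[ℝ] F) → F × (F →L[ℝ] F)} {z₀ : F × (F →L[ℝ] F)},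
      ContDiffAt ℝ (k + 1 : ℕ) g z₀ → ∀ {W : Set (F × (F →L[ℝ] F))}, W ∈ 𝓝 z₀ →
      ∃ φ ε U, z₀ ∈ U ∧ IsLocalFlow g k φ ε U W)
    {W : Set F} (hW : W ∈ 𝓝 x₀) :
    ∃ φ ε U, x₀ ∈ U ∧ IsLocalFlow f (k + 1) φ ε U W ∧ ∀ x ∈ U, ∀ t ∈ Ioo (-ε) ε,
      HasDerivAt (fun τ => fderiv ℝ (φ τ) x) ((fderiv ℝ f (φ t x)).comp (fderiv ℝ (φ t) x)) t := by
  have hf' : ContDiffAt ℝ (k + 1 : ℕ) (fderiv ℝ f) x₀ :=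
    hf.fderiv_right (by norm_cast)
  obtain ⟨C, s, hs, hC⟩ := (hf'.of_le (m := 1) (by norm_cast; omega)).exists_lipschitzOnWith
  have hdiff : ∀ᶠ y in 𝓝 x₀, DifferentiableAt ℝ f y := by
    filter_upwards [(hf.of_le (m := 1) (by norm_cast; omega)).eventually (by simp)] with y hy
    exact hy.differentiableAt one_ne_zero
  have hbd : ∀ᶠ y in 𝓝 x₀, ‖fderiv ℝ f y‖ < ‖fderiv ℝ f x₀‖ + 1 :=
    hf'.continuousAt.norm.eventually_lt_const (lt_add_one _)
  obtain ⟨r, hr, hball⟩ := Metric.mem_nhds_iff.1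
    (Filter.inter_mem (Filter.inter_mem hW hs) (hdiff.and hbd))
  set K := max (C : ℝ) (‖fderiv ℝ f x₀‖ + 1)
  let g : F × (F →L[ℝ] F) → F × (F →L[ℝ] F) := fun z => (f z.1, (fderiv ℝ f z.1).comp z.2)
  have hg : ContDiffAt ℝ (k + 1 : ℕ) g (x₀, ContinuousLinearMap.id ℝ F) := by
    refine ContDiffAt.prodMk ?_ (ContDiffAt.clm_comp ?_ contDiffAt_snd)
    · exact (hf.of_le (by norm_cast; omega)).comp (x₀, ContinuousLinearMap.id ℝ F) contDiffAt_fst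
    · exact hf'.comp (x₀, ContinuousLinearMap.id ℝ F) contDiffAt_fst
  -- Only the base component is confined, to a ball: convexity is needed for the mean value
  -- inequality, while `A` may be arbitrary.
  obtain ⟨ψ, ε, U', hx₀, hψ⟩ := ih hg (W := ball x₀ r ×ˢ univ)
    (prod_mem_nhds (ball_mem_nhds _ hr) Filter.univ_mem)
  have hι : Continuous fun x : F => (x, ContinuousLinearMap.id ℝ F) := by fun_prop
  set U := (fun x : F => (x, ContinuousLinearMap.id ℝ F)) ⁻¹' U' with hUdef
  have hU : IsOpen U := hψ.isOpen.preimage hι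
  set φ : ℝ → F → F := fun t x => (ψ t (x, ContinuousLinearMap.id ℝ F)).1 with hφdef
  set A : ℝ → F → F →L[ℝ] F := fun t x => (ψ t (x, ContinuousLinearMap.id ℝ F)).2 with hAdef
  have hmem : ∀ x ∈ U, ∀ t ∈ Ioo (-ε) ε, φ t x ∈ ball x₀ r := fun x hx t ht =>
    (hψ.mem _ hx t ht).1
  have hzero : ∀ x ∈ U, φ 0 x = x := fun x hx => by simp [hφdef, hψ.zero _ hx]
  have hφ : ∀ x ∈ U, ∀ t ∈ Ioo (-ε) ε, HasDerivAt (fun τ => φ τ x) (f (φ t x)) t :=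
    fun x hx t ht =>
      (ContinuousLinearMap.fst ℝ F (F →L[ℝ] F)).hasFDerivAt.comp_hasDerivAt t
        (hψ.hasDerivAt _ hx t ht)
  have hA : ∀ x ∈ U, ∀ t ∈ Ioo (-ε) ε,
      HasDerivAt (fun τ => A τ x) ((fderiv ℝ f (φ t x)).comp (A t x)) t :=
    fun x hx t ht =>
      (ContinuousLinearMap.snd ℝ F (F →L[ℝ] F)).hasFDerivAt.comp_hasDerivAt t
        (hψ.hasDerivAt _ hx t ht)
  have hD : ∀ x ∈ U, ∀ t ∈ Ioo (-ε) ε, HasFDerivAt (φ t) (A t x) x := fun x hx t ht =>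
    hasFDerivAt_of_variational (f := f) (K := K) (A := fun τ => A τ x) (hU.mem_nhds hx)
      (convex_ball x₀ r) (fun y hy => (hball hy).2.1.hasFDerivAt)
      (fun y hy => (hball hy).2.2.le.trans (le_max_right _ _))
      (fun y hy z hz => (hC.norm_sub_le (hball hy).1.2 (hball hz).1.2).trans
        (mul_le_mul_of_nonneg_right (le_max_left _ _) (norm_nonneg _)))
      hzero hmem hφ (by simp [hAdef, hψ.zero _ hx]) (hA x hx) ht
  have hιs : ContDiff ℝ k fun x : F => (x, ContinuousLinearMap.id ℝ F) :=
    contDiff_id.prodMk contDiff_const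
  refine ⟨φ, ε, U, hx₀, ⟨hψ.pos, hU, hzero, fun x hx t ht => (hball (hmem x hx t ht)).1.1, hφ,
    fun t ht => ?_⟩, fun x hx t ht => ?_⟩
  · push_cast
    rw [contDiffOn_succ_iff_fderiv_of_isOpen hU]
    refine ⟨fun x hx => (hD x hx t ht).differentiableAt.differentiableWithinAt, by simp, ?_⟩
    refine ContDiffOn.congr (f := A t) ?_ fun x hx => (hD x hx t ht).fderiv
    exact ((hψ.contDiffOn t ht).comp hιs.contDiffOn fun x hx => hx).snd
  · rw [(hD x hx t ht).fderiv]
    refine (hA x hx t ht).congr_of_eventuallyEq ?_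
    filter_upwards [Ioo_mem_nhds ht.1 ht.2] with τ hτ
    exact (hD x hx τ hτ).fderiv

-- The space varies in the induction because each step enlarges it; the enlarged space stays in the
-- same universe.
universe u in
theorem exists_isLocalFlow (k : ℕ) : ∀ {F : Type u} [NormedAddCommGroup F] [NormedSpace ℝ F]
    [CompleteSpace F] {f : F → F} {x₀ : F}, ContDiffAt ℝ (k + 1 : ℕ) f x₀ →
    ∀ {W : Set F}, W ∈ 𝓝 x₀ → ∃ φ ε U, x₀ ∈ U ∧ IsLocalFlow f k φ ε U W := by
  induction k with
  | zero =>
    intro F _ _ _ f x₀ hf W hW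
    exact exists_isLocalFlow_zero (by simpa using hf) hW
  | succ k ih =>
    intro F _ _ _ f x₀ hf W hW
    obtain ⟨φ, ε, U, hx, h, -⟩ := exists_isLocalFlow_succ hf ih hW
    exact ⟨φ, ε, U, hx, h⟩

/-- A smooth vector field has a `C²` local flow, whose derivative solves the linearized
equation. -/
theorem exists_isLocalFlow_two [CompleteSpace F] {f : F → F} {x₀ : F} (hf : ContDiffAt ℝ 3 f x₀)
    {W : Set F} (hW : W ∈ 𝓝 x₀) :
    ∃ φ ε U, x₀ ∈ U ∧ IsLocalFlow f 2 φ ε U W ∧ ∀ x ∈ U, ∀ t ∈ Ioo (-ε) ε,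
      HasDerivAt (fun τ => fderiv ℝ (φ τ) x) ((fderiv ℝ f (φ t x)).comp (fderiv ℝ (φ t) x)) t :=
  exists_isLocalFlow_succ (k := 1) hf (fun hg => exists_isLocalFlow 1 hg) hW

end FlatFlow

/-! ### Metric, Christoffel symbols and fields in the preferred charts -/

section Charts

variable {E : Type*} [NormedAddCommGroup E] [NormedSpace ℝ E]
  {M : Type*} [TopologicalSpace M] [ChartedSpace E M] [IsManifold 𝓘(ℝ, E) ∞ M]

/-- The derivative at `y` of the preferred chart around `x`. -/
def chartDeriv (x y : M) : E →L[ℝ] E :=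
  mfderiv 𝓘(ℝ, E) 𝓘(ℝ, E) (extChartAt 𝓘(ℝ, E) x) y

theorem isManifold_one : IsManifold 𝓘(ℝ, E) 1 M := .of_le (n := ∞) (by simp)

theorem chartInvDeriv_comp_chartDeriv {x y : M} (hy : y ∈ (extChartAt 𝓘(ℝ, E) x).source) :
    (chartInvDeriv x (extChartAt 𝓘(ℝ, E) x y)).comp (chartDeriv x y) =
      ContinuousLinearMap.id ℝ E := by
  have : IsManifold 𝓘(ℝ, E) 1 M := isManifold_one
  have := mfderivWithin_extChartAt_symm_comp_mfderiv_extChartAt' (I := 𝓘(ℝ, E)) hy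
  rw [ModelWithCorners.range_eq_univ, mfderivWithin_univ] at this
  exact this

theorem chartDeriv_comp_chartInvDeriv {x y : M} (hy : y ∈ (extChartAt 𝓘(ℝ, E) x).source) :
    (chartDeriv x y).comp (chartInvDeriv x (extChartAt 𝓘(ℝ, E) x y)) =
      ContinuousLinearMap.id ℝ E := by
  have : IsManifold 𝓘(ℝ, E) 1 M := isManifold_one
  have := mfderiv_extChartAt_comp_mfderivWithin_extChartAt_symm' (I := 𝓘(ℝ, E)) hy
  rw [ModelWithCorners.range_eq_univ, mfderivWithin_univ] at this
  exact this

theorem chartDeriv_self (x : M) : chartDeriv x x = ContinuousLinearMap.id ℝ E := by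
  have : IsManifold 𝓘(ℝ, E) 1 M := isManifold_one
  exact mfderiv_extChartAt_self

theorem chartInvDeriv_self (x : M) :
    chartInvDeriv x (extChartAt 𝓘(ℝ, E) x x) = ContinuousLinearMap.id ℝ E := by
  have := chartInvDeriv_comp_chartDeriv (mem_extChartAt_source (I := 𝓘(ℝ, E)) x)
  rwa [chartDeriv_self, ContinuousLinearMap.comp_id] at this

theorem chartInvDeriv_chartDeriv_apply {x y : M} (hy : y ∈ (extChartAt 𝓘(ℝ, E) x).source)
    (v : E) : chartInvDeriv x (extChartAt 𝓘(ℝ, E) x y) (chartDeriv x y v) = v :=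
  DFunLike.congr_fun (chartInvDeriv_comp_chartDeriv hy) v

theorem chartDeriv_chartInvDeriv_apply {x y : M} (hy : y ∈ (extChartAt 𝓘(ℝ, E) x).source)
    (v : E) : chartDeriv x y (chartInvDeriv x (extChartAt 𝓘(ℝ, E) x y) v) = v :=
  DFunLike.congr_fun (chartDeriv_comp_chartInvDeriv hy) v

/-- The metric, as a bilinear form on the copy `E` of the tangent space. -/
def innerE (g : Metric E M) (y : M) : E →L[ℝ] E →L[ℝ] ℝ := g.inner y

theorem innerE_symm (g : Metric E M) (y : M) (u v : E) : innerE g y u v = innerE g y v u :=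
  g.symm y u v

theorem innerE_pos (g : Metric E M) (y : M) {u : E} (hu : u ≠ 0) : 0 < innerE g y u u :=
  g.pos y u hu

theorem chartMetric_apply (g : Metric E M) (x : M) (p u v : E) :
    chartMetric g x p u v =
      innerE g ((extChartAt 𝓘(ℝ, E) x).symm p) (chartInvDeriv x p u) (chartInvDeriv x p v) := rfl

theorem chartMetric_symm (g : Metric E M) (x : M) (p u v : E) :
    chartMetric g x p u v = chartMetric g x p v u := by
  rw [chartMetric_apply, innerE_symm, ← chartMetric_apply]

theorem chartMetric_extChartAt_apply (g : Metric E M) {x y : M}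
    (hy : y ∈ (extChartAt 𝓘(ℝ, E) x).source) (u v : E) :
    chartMetric g x (extChartAt 𝓘(ℝ, E) x y) u v =
      innerE g y (chartInvDeriv x (extChartAt 𝓘(ℝ, E) x y) u)
        (chartInvDeriv x (extChartAt 𝓘(ℝ, E) x y) v) := by
  rw [chartMetric_apply, (extChartAt 𝓘(ℝ, E) x).left_inv hy]

theorem innerE_eq_chartMetric (g : Metric E M) {x y : M}
    (hy : y ∈ (extChartAt 𝓘(ℝ, E) x).source) (u v : E) :
    innerE g y u v =
      chartMetric g x (extChartAt 𝓘(ℝ, E) x y) (chartDeriv x y u) (chartDeriv x y v) := by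
  rw [chartMetric_extChartAt_apply g hy, chartInvDeriv_chartDeriv_apply hy,
    chartInvDeriv_chartDeriv_apply hy]

theorem chartMetric_self (g : Metric E M) (x : M) :
    chartMetric g x (extChartAt 𝓘(ℝ, E) x x) = innerE g x := by
  ext u v
  rw [chartMetric_extChartAt_apply g (mem_extChartAt_source x), chartInvDeriv_self]
  rfl

/-- Smoothness of `g` means smoothness of its coordinates in the bundle trivialization at `x`. The
inverse trivialization is the derivative of the inverse chart, so these coordinates are
`chartMetric`. -/
theorem contDiffAt_chartMetric (g : Metric E M) (x : M) :
    ContDiffAt ℝ ∞ (chartMetric g x) (extChartAt 𝓘(ℝ, E) x x) := by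
  have : IsManifold 𝓘(ℝ, E) 1 M := isManifold_one
  have h := (contMDiffAt_hom_bundle _).1 (g.contMDiff.contMDiffAt (x := x)) |>.2
  have hs : ContMDiffAt 𝓘(ℝ, E) 𝓘(ℝ, E) ∞ (extChartAt 𝓘(ℝ, E) x).symm
      (extChartAt 𝓘(ℝ, E) x x) :=
    (contMDiffOn_extChartAt_symm x).contMDiffAt (extChartAt_target_mem_nhds x)
  have hx : (extChartAt 𝓘(ℝ, E) x).symm (extChartAt 𝓘(ℝ, E) x x) = x := extChartAt_to_inv x
  rw [← hx] at h
  have h2 := (ContMDiffAt.comp _ h hs).contDiffAt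
  refine h2.congr_of_eventuallyEq ?_
  filter_upwards [extChartAt_target_mem_nhds (I := 𝓘(ℝ, E)) x] with p hp
  have hy := (extChartAt 𝓘(ℝ, E) x).map_target hp
  have hy' : (extChartAt 𝓘(ℝ, E) x).symm p ∈ (chartAt E x).source := by simpa using hy
  have hφ : extChartAt 𝓘(ℝ, E) x ((extChartAt 𝓘(ℝ, E) x).symm p) = p :=
    (extChartAt 𝓘(ℝ, E) x).right_inv hp
  have hsymm : ∀ u : E, (trivializationAt E (TangentSpace 𝓘(ℝ, E)) x).symm
      ((extChartAt 𝓘(ℝ, E) x).symm p) u = chartInvDeriv x p u := fun u => by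
    have h := TangentBundle.symmL_trivializationAt (I := 𝓘(ℝ, E)) hy'
    rw [hφ, ModelWithCorners.range_eq_univ, mfderivWithin_univ] at h
    exact ((trivializationAt E (TangentSpace 𝓘(ℝ, E)) x).symmL_apply (R := ℝ) hy' u).symm.trans
      (DFunLike.congr_fun h u)
  ext u v
  simp only [Function.comp_apply, hx]
  refine Eq.trans ?_ (inCoordinates_apply_eq₂ (F₁ := E) (F₂ := E) (F₃ := ℝ)
    (E₁ := (TangentSpace 𝓘(ℝ, E) : M → Type _)) (E₂ := (TangentSpace 𝓘(ℝ, E) : M → Type _))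
    (E₃ := Bundle.Trivial M ℝ) (x₀ := x) hy' hy' (Set.mem_univ _)).symm
  have hid : ∀ c : ℝ, (trivializationAt ℝ (Bundle.Trivial M ℝ) x).linearMapAt ℝ
      ((extChartAt 𝓘(ℝ, E) x).symm p) c = c := fun c => by simp
  refine Eq.trans ?_ (hid _).symm
  exact (congrArg₂ (fun a b => innerE g ((extChartAt 𝓘(ℝ, E) x).symm p) a b)
    (hsymm u) (hsymm v)).symm

theorem differentiableAt_chartMetric (g : Metric E M) (x : M) :
    DifferentiableAt ℝ (chartMetric g x) (extChartAt 𝓘(ℝ, E) x x) :=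
  (contDiffAt_chartMetric g x).differentiableAt (by simp)

theorem fderiv_chartMetric_symm (g : Metric E M) (x : M) (w u v : E) :
    fderiv ℝ (chartMetric g x) (extChartAt 𝓘(ℝ, E) x x) w u v =
      fderiv ℝ (chartMetric g x) (extChartAt 𝓘(ℝ, E) x x) w v u := by
  have h := (differentiableAt_chartMetric g x).hasFDerivAt
  have h1 := (h.clm_apply (hasFDerivAt_const u _)).clm_apply (hasFDerivAt_const v _)
  have h2 := (h.clm_apply (hasFDerivAt_const v _)).clm_apply (hasFDerivAt_const u _)
  simp only [chartMetric_symm g x _ u v] at h1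
  simpa using DFunLike.congr_fun (h1.unique h2) w

theorem isInvertible_of_pos [FiniteDimensional ℝ E] {B : E →L[ℝ] E →L[ℝ] ℝ}
    (hB : ∀ u, u ≠ 0 → 0 < B u u) : B.IsInvertible := by
  let L : E →ₗ[ℝ] (E →L[ℝ] ℝ) := B
  have hinj : Function.Injective L := by
    refine (injective_iff_map_eq_zero L).2 fun u hu => ?_
    by_contra hne
    have h0 : B u u = 0 := by
      change (L u) u = 0
      simp [hu]
    exact (hB u hne).ne' h0
  have hrank : Module.finrank ℝ E = Module.finrank ℝ (E →L[ℝ] ℝ) := by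
    rw [← (LinearMap.toContinuousLinearMap (𝕜 := ℝ) (E := E) (F' := ℝ)).finrank_eq]
    exact (Subspace.dual_finrank_eq (K := ℝ) (V := E)).symm
  refine ⟨(LinearEquiv.ofBijective L ⟨hinj,
    (LinearMap.injective_iff_surjective_of_finrank_eq_finrank hrank).1 hinj⟩).toContinuousLinearEquiv,
    ?_⟩
  ext u v
  rfl

/-- `ContinuousLinearMap.inverse` is zero on non-invertible maps, so the defining identity of the
Christoffel symbols needs positivity of `g` and finite dimension. -/
theorem innerE_christoffel [FiniteDimensional ℝ E] (g : Metric E M) (x : M) (u v w : E) :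
    innerE g x (christoffel g x (extChartAt 𝓘(ℝ, E) x x) u v) w =
      christoffelFirst g x (extChartAt 𝓘(ℝ, E) x x) u v w := by
  rw [← chartMetric_self]
  have hinv : (chartMetric g x (extChartAt 𝓘(ℝ, E) x x)).IsInvertible := by
    rw [chartMetric_self]
    exact isInvertible_of_pos fun u hu => innerE_pos g x hu
  exact DFunLike.congr_fun
    ((hinv.inverse_apply_eq (y := christoffelFirst g x (extChartAt 𝓘(ℝ, E) x x) u v)).1 rfl).symm w

theorem christoffelFirst_apply (g : Metric E M) (x : M) (p u v w : E) :
    christoffelFirst g x p u v w = 1 / 2 * (fderiv ℝ (chartMetric g x) p u v w +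
      fderiv ℝ (chartMetric g x) p v u w - fderiv ℝ (chartMetric g x) p w u v) := rfl

/-- The value of a vector field, as an element of the copy `E` of the tangent space. -/
def fieldE (X : (x : M) → TangentSpace 𝓘(ℝ, E) x) (x : M) : E := X x

/-- The vector field `X` in the preferred chart around `x`. -/
def chartField (X : (x : M) → TangentSpace 𝓘(ℝ, E) x) (x : M) : E → E :=
  VectorField.mpullback 𝓘(ℝ, E) 𝓘(ℝ, E) (extChartAt 𝓘(ℝ, E) x).symm X

omit [IsManifold 𝓘(ℝ, E) ∞ M] in
theorem chartField_apply (X : (x : M) → TangentSpace 𝓘(ℝ, E) x) (x : M) (p : E) :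
    chartField X x p =
      (chartInvDeriv x p).inverse (fieldE X ((extChartAt 𝓘(ℝ, E) x).symm p)) := rfl

theorem chartField_extChartAt (X : (x : M) → TangentSpace 𝓘(ℝ, E) x) {x y : M}
    (hy : y ∈ (extChartAt 𝓘(ℝ, E) x).source) :
    chartField X x (extChartAt 𝓘(ℝ, E) x y) = chartDeriv x y (fieldE X y) := by
  rw [chartField_apply, ContinuousLinearMap.inverse_eq (chartInvDeriv_comp_chartDeriv hy)
    (chartDeriv_comp_chartInvDeriv hy), (extChartAt 𝓘(ℝ, E) x).left_inv hy]

theorem chartField_self (X : (x : M) → TangentSpace 𝓘(ℝ, E) x) (x : M) :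
    chartField X x (extChartAt 𝓘(ℝ, E) x x) = fieldE X x := by
  rw [chartField_extChartAt X (mem_extChartAt_source x), chartDeriv_self,
    ContinuousLinearMap.id_apply]

theorem IsSmoothField.contDiffAt_chartField [CompleteSpace E]
    {X : (x : M) → TangentSpace 𝓘(ℝ, E) x}
    (hX : IsSmoothField X) (x : M) :
    ContDiffAt ℝ ∞ (chartField X x) (extChartAt 𝓘(ℝ, E) x x) := by
  have : IsManifold 𝓘(ℝ, E) 1 M := isManifold_one
  have h := VectorField.contMDiffWithinAt_mpullbackWithin_extChartAt_symm (I := 𝓘(ℝ, E))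
    (m := ∞) (n := ∞) (s := Set.univ) (hX.contMDiffAt (x := x)).contMDiffWithinAt
    uniqueMDiffOn_univ (Set.mem_univ x) (by simp)
  rw [ModelWithCorners.range_eq_univ, VectorField.mpullbackWithin_univ, Set.preimage_univ,
    Set.inter_univ] at h
  exact contMDiffAt_vectorSpace_iff_contDiffAt.1
    (h.contMDiffAt (extChartAt_target_mem_nhds x))

theorem IsSmoothField.hasFDerivAt_chartField [CompleteSpace E]
    {X : (x : M) → TangentSpace 𝓘(ℝ, E) x}
    (hX : IsSmoothField X) (x : M) :
    HasFDerivAt (chartField X x) (fderiv ℝ (chartField X x) (extChartAt 𝓘(ℝ, E) x x))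
      (extChartAt 𝓘(ℝ, E) x x) :=
  ((hX.contDiffAt_chartField x).differentiableAt (by simp)).hasFDerivAt

/-- The Lie derivative of the metric along a Killing field vanishes. -/
theorem IsKilling.chart_eq_zero [FiniteDimensional ℝ E] {g : Metric E M}
    {X : (x : M) → TangentSpace 𝓘(ℝ, E) x} (h : IsKilling g X) (x : M) (u w : E) :
    fderiv ℝ (chartMetric g x) (extChartAt 𝓘(ℝ, E) x x) (fieldE X x) u w +
      innerE g x (fderiv ℝ (chartField X x) (extChartAt 𝓘(ℝ, E) x x) u) w +
      innerE g x u (fderiv ℝ (chartField X x) (extChartAt 𝓘(ℝ, E) x x) w) = 0 := by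
  have h1 : innerE g x (fderiv ℝ (chartField X x) (extChartAt 𝓘(ℝ, E) x x) u +
      christoffel g x (extChartAt 𝓘(ℝ, E) x x) u (fieldE X x)) w +
      innerE g x (fderiv ℝ (chartField X x) (extChartAt 𝓘(ℝ, E) x x) w +
      christoffel g x (extChartAt 𝓘(ℝ, E) x x) w (fieldE X x)) u = 0 := h x u w
  -- By symmetry of `g`, the two first-kind symbols add up to the derivative of `g` along `X`; the
  -- other terms cancel.
  rw [map_add, map_add, _root_.add_apply,
    _root_.add_apply, innerE_christoffel, innerE_christoffel, christoffelFirst_apply,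
    christoffelFirst_apply, fderiv_chartMetric_symm g x u (fieldE X x) w,
    fderiv_chartMetric_symm g x w (fieldE X x) u, fderiv_chartMetric_symm g x (fieldE X x) w u,
    innerE_symm g x _ u] at h1
  linarith

/-- The manifold bracket is the flat bracket in the chart, pulled back by a derivative that is the
identity at the centre. -/
theorem fderiv_chartField_comm [CompleteSpace E] {X V : (x : M) → TangentSpace 𝓘(ℝ, E) x} {x : M}
    (h : VectorField.mlieBracket 𝓘(ℝ, E) X V x = 0) :
    fderiv ℝ (chartField V x) (extChartAt 𝓘(ℝ, E) x x) (fieldE X x) =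
      fderiv ℝ (chartField X x) (extChartAt 𝓘(ℝ, E) x x) (fieldE V x) := by
  have h1 : (chartDeriv x x).inverse (VectorField.lieBracketWithin ℝ
      (VectorField.mpullbackWithin 𝓘(ℝ, E) 𝓘(ℝ, E) (extChartAt 𝓘(ℝ, E) x).symm X
        (Set.range 𝓘(ℝ, E)))
      (VectorField.mpullbackWithin 𝓘(ℝ, E) 𝓘(ℝ, E) (extChartAt 𝓘(ℝ, E) x).symm V
        (Set.range 𝓘(ℝ, E))) ((extChartAt 𝓘(ℝ, E) x).symm ⁻¹' Set.univ ∩ Set.range 𝓘(ℝ, E))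
      (extChartAt 𝓘(ℝ, E) x x)) = 0 := h
  rw [chartDeriv_self, ContinuousLinearMap.inverse_id, ModelWithCorners.range_eq_univ,
    Set.preimage_univ, Set.inter_univ, VectorField.mpullbackWithin_univ,
    VectorField.mpullbackWithin_univ] at h1
  have h2 : fderiv ℝ (chartField V x) (extChartAt 𝓘(ℝ, E) x x)
        (chartField X x (extChartAt 𝓘(ℝ, E) x x)) -
      fderiv ℝ (chartField X x) (extChartAt 𝓘(ℝ, E) x x)
        (chartField V x (extChartAt 𝓘(ℝ, E) x x)) = 0 := by
    have h3 := congrFun (VectorField.lieBracketWithin_univ (𝕜 := ℝ) (V := chartField X x)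
      (W := chartField V x)) (extChartAt 𝓘(ℝ, E) x x)
    exact h3.symm.trans h1
  rw [chartField_self, chartField_self] at h2
  exact sub_eq_zero.1 h2

end Charts

/-! ### Local flows on the manifold -/

section LocalFlow

variable {E : Type*} [NormedAddCommGroup E] [NormedSpace ℝ E]
  {M : Type*} [TopologicalSpace M] [ChartedSpace E M]

/-- The derivative of a map `M → M`, as an endomorphism of the copy `E` of the tangent spaces. -/
def mapDeriv (Φ : M → M) (p : M) : E →L[ℝ] E := mfderiv 𝓘(ℝ, E) 𝓘(ℝ, E) Φ p

theorem hasMFDerivAt_mapDeriv {Φ : M → M} {p : M} (h : MDifferentiableAt 𝓘(ℝ, E) 𝓘(ℝ, E) Φ p) :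
    HasMFDerivAt 𝓘(ℝ, E) 𝓘(ℝ, E) Φ p (mapDeriv (E := E) Φ p) := h.hasMFDerivAt

theorem mapDeriv_eq {Φ : M → M} {p : M} {A : E →L[ℝ] E}
    (h : HasMFDerivAt 𝓘(ℝ, E) 𝓘(ℝ, E) Φ p A) : mapDeriv Φ p = A := h.mfderiv

theorem mapDeriv_comp {Φ Ψ : M → M} {p : M} (hΨ : MDifferentiableAt 𝓘(ℝ, E) 𝓘(ℝ, E) Ψ (Φ p))
    (hΦ : MDifferentiableAt 𝓘(ℝ, E) 𝓘(ℝ, E) Φ p) :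
    mapDeriv (Ψ ∘ Φ) p = (mapDeriv Ψ (Φ p)).comp (mapDeriv Φ p : E →L[ℝ] E) :=
  mapDeriv_eq (HasMFDerivAt.comp p (hasMFDerivAt_mapDeriv hΨ) (hasMFDerivAt_mapDeriv hΦ))

theorem mapDeriv_congr {Φ Ψ : M → M} {p : M} (h : Φ =ᶠ[𝓝 p] Ψ) :
    (mapDeriv Φ p : E →L[ℝ] E) = mapDeriv Ψ p := by
  unfold mapDeriv
  exact h.mfderiv_eq

theorem mapDeriv_id (p : M) : mapDeriv (id : M → M) p = ContinuousLinearMap.id ℝ E :=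
  mapDeriv_eq (hasMFDerivAt_id p)

variable [IsManifold 𝓘(ℝ, E) ∞ M]

theorem hasMFDerivAt_chart {x y : M} (hy : y ∈ (extChartAt 𝓘(ℝ, E) x).source) :
    HasMFDerivAt 𝓘(ℝ, E) 𝓘(ℝ, E) (extChartAt 𝓘(ℝ, E) x) y (chartDeriv (E := E) x y) := by
  have : IsManifold 𝓘(ℝ, E) 1 M := isManifold_one
  exact (mdifferentiableAt_extChartAt (by simpa using hy)).hasMFDerivAt

theorem hasMFDerivAt_chart_symm {x : M} {q : E} (hq : q ∈ (extChartAt 𝓘(ℝ, E) x).target) :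
    HasMFDerivAt 𝓘(ℝ, E) 𝓘(ℝ, E) (extChartAt 𝓘(ℝ, E) x).symm q (chartInvDeriv (E := E) x q) := by
  have : IsManifold 𝓘(ℝ, E) 1 M := isManifold_one
  have h := mdifferentiableWithinAt_extChartAt_symm (I := 𝓘(ℝ, E)) hq
  rw [ModelWithCorners.range_eq_univ, mdifferentiableWithinAt_univ] at h
  exact h.hasMFDerivAt

/-- The field in a chart, transported back to the manifold. -/
theorem chartInvDeriv_chartField (X : (x : M) → TangentSpace 𝓘(ℝ, E) x) {x : M} {q : E}
    (hq : q ∈ (extChartAt 𝓘(ℝ, E) x).target) :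
    chartInvDeriv x q (chartField X x q) = fieldE X ((extChartAt 𝓘(ℝ, E) x).symm q) := by
  have hy := (extChartAt 𝓘(ℝ, E) x).map_target hq
  have h1 := chartInvDeriv_chartDeriv_apply hy (fieldE X ((extChartAt 𝓘(ℝ, E) x).symm q))
  rwa [← chartField_extChartAt X hy, (extChartAt 𝓘(ℝ, E) x).right_inv hq] at h1

/-- A smooth vector field on a manifold has a local `C²` flow, whose derivative at the centre
solves the linearized equation at time `0`. -/
theorem exists_local_flow [CompleteSpace E] {X : (x : M) → TangentSpace 𝓘(ℝ, E) x}
    (hX : IsSmoothField X) (x : M) :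
    ∃ (Φ : ℝ → M → M) (ε : ℝ) (N : Set M), 0 < ε ∧ IsOpen N ∧ x ∈ N ∧ (∀ y ∈ N, Φ 0 y = y) ∧
      (∀ y ∈ N, IsMIntegralCurveOn (fun h => Φ h y) X (Set.Ioo (-ε) ε)) ∧
      (∀ h ∈ Set.Ioo (-ε) ε, ContMDiffOn 𝓘(ℝ, E) 𝓘(ℝ, E) 2 (Φ h) N) ∧
      ∀ u : E, HasDerivAt (fun h => chartDeriv x (Φ h x) (mapDeriv (Φ h) x u))
        (fderiv ℝ (chartField X x) (extChartAt 𝓘(ℝ, E) x x) u) 0 := by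
  obtain ⟨ψ, ε, U, hxU, hψ, hvar⟩ := exists_isLocalFlow_two
    (contDiffAt_infty.1 (hX.contDiffAt_chartField x) 3)
    (extChartAt_target_mem_nhds (I := 𝓘(ℝ, E)) x)
  set e := extChartAt 𝓘(ℝ, E) x with he
  have hN : IsOpen (e.source ∩ e ⁻¹' U) :=
    (continuousOn_extChartAt x).isOpen_inter_preimage (isOpen_extChartAt_source x) hψ.isOpen
  have h0 : (0 : ℝ) ∈ Set.Ioo (-ε) ε := ⟨by linarith [hψ.pos], hψ.pos⟩
  have hxs : x ∈ e.source := mem_extChartAt_source x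
  have hder : ∀ h ∈ Set.Ioo (-ε) ε,
      mapDeriv (fun y => e.symm (ψ h (e y))) x =
        (chartInvDeriv x (ψ h (e x))).comp (fderiv ℝ (ψ h) (e x)) := fun h hh => by
    have hd : DifferentiableAt ℝ (ψ h) (e x) :=
      ((hψ.contDiffOn h hh).contDiffAt (hψ.isOpen.mem_nhds hxU)).differentiableAt (by simp)
    have h1 := (hasMFDerivAt_chart_symm (hψ.mem _ hxU h hh)).comp (e x)
      hd.hasFDerivAt.hasMFDerivAt
    have h2 := mapDeriv_eq (HasMFDerivAt.comp x h1 (hasMFDerivAt_chart hxs))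
    refine Eq.trans h2 ?_
    rw [chartDeriv_self]
    rfl
  refine ⟨fun h y => e.symm (ψ h (e y)), ε, e.source ∩ e ⁻¹' U, hψ.pos, hN, ⟨hxs, hxU⟩,
    fun y hy => ?_, fun y hy h hh => ?_, fun h hh => ?_, fun u => ?_⟩
  · simp only [hψ.zero _ hy.2]
    exact e.left_inv hy.1
  · have h1 := hψ.hasDerivAt _ hy.2 h hh
    have h2 := (hasMFDerivAt_chart_symm (hψ.mem _ hy.2 h hh)).comp h
      h1.hasFDerivAt.hasMFDerivAt
    refine HasMFDerivAt.hasMFDerivWithinAt ?_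
    refine h2.congr_mfderiv ?_
    refine ContinuousLinearMap.ext fun c : ℝ => ?_
    refine ((chartInvDeriv x (ψ h (e y))).map_smul c (chartField X x (ψ h (e y)))).trans ?_
    exact congrArg (fun v : E => c • v) (chartInvDeriv_chartField X (hψ.mem _ hy.2 h hh))
  · have h1 : ContMDiffOn 𝓘(ℝ, E) 𝓘(ℝ, E) 2 e e.source := by
      rw [he, extChartAt_source]
      exact contMDiffOn_extChartAt
    have h2 : ContMDiffOn 𝓘(ℝ, E) 𝓘(ℝ, E) 2 e.symm e.target := contMDiffOn_extChartAt_symm x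
    have h3 : ContMDiffOn 𝓘(ℝ, E) 𝓘(ℝ, E) 2 (ψ h) U := (hψ.contDiffOn h hh).contMDiffOn
    exact h2.comp (h3.comp (h1.mono Set.inter_subset_left) fun y hy => hy.2)
      fun y hy => hψ.mem _ hy.2 h hh
  · have h1 := (hvar _ hxU 0 h0).clm_apply (hasDerivAt_const 0 u)
    have hid : fderiv ℝ (ψ 0) (e x) = ContinuousLinearMap.id ℝ E := by
      have : ψ 0 =ᶠ[𝓝 (e x)] id := by
        filter_upwards [hψ.isOpen.mem_nhds hxU] with z hz using hψ.zero z hz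
      rw [this.fderiv_eq, fderiv_id]
    simp only [hid, hψ.zero _ hxU, ContinuousLinearMap.comp_id, map_zero, add_zero] at h1
    refine h1.congr_of_eventuallyEq ?_
    filter_upwards [Ioo_mem_nhds h0.1 h0.2] with h hh
    have hmem := hψ.mem _ hxU h hh
    have h3 := chartDeriv_chartInvDeriv_apply (e.map_target hmem) (fderiv ℝ (ψ h) (e x) u)
    rw [e.right_inv hmem] at h3
    rw [hder h hh]
    exact h3

end LocalFlow

/-! ### Time-`τ` maps along an integral curve, and Lie transport -/

section GlobalFlow

open Set

variable {E : Type*} [NormedAddCommGroup E] [NormedSpace ℝ E]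
  {M : Type*} [TopologicalSpace M] [ChartedSpace E M]
  {X : (x : M) → TangentSpace 𝓘(ℝ, E) x}

theorem IsMIntegralCurveOn.flowsTo {c : ℝ → M} {a b s : ℝ}
    (hc : IsMIntegralCurveOn c X (Ioo a b)) (h0 : (0 : ℝ) ∈ Ioo a b) (hs : s ∈ Ioo a b) :
    FlowsTo X s (c 0) (c s) :=
  ⟨a, b, c, h0, hs, hc, rfl, rfl⟩

variable [IsManifold 𝓘(ℝ, E) ∞ M]

theorem exists_local_flow_flowsTo [CompleteSpace E] (hX : IsSmoothField X) (x : M) :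
    ∃ (Φ : ℝ → M → M) (ε : ℝ) (N : Set M), 0 < ε ∧ IsOpen N ∧ x ∈ N ∧
      (∀ y ∈ N, ∀ h ∈ Ioo (-ε) ε, FlowsTo X h y (Φ h y)) ∧
      (∀ h ∈ Ioo (-ε) ε, ContMDiffOn 𝓘(ℝ, E) 𝓘(ℝ, E) 2 (Φ h) N) ∧
      ∀ u : E, HasDerivAt (fun h => chartDeriv x (Φ h x) (mapDeriv (Φ h) x u))
        (fderiv ℝ (chartField X x) (extChartAt 𝓘(ℝ, E) x x) u) 0 := by
  obtain ⟨Φ, ε, N, hε, hN, hx, h0, hc, hs, hd⟩ := exists_local_flow hX x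
  refine ⟨Φ, ε, N, hε, hN, hx, fun y hy h hh => ?_, hs, hd⟩
  have := IsMIntegralCurveOn.flowsTo (hc y hy) ⟨by linarith, hε⟩ hh
  simpa [h0 y hy] using this

/-- The vectors `a τ`, tangent to `M` at `c τ`, are invariant under the flow of `X` to first
order at `τ₀`. -/
def LieTransportedAt (X : (x : M) → TangentSpace 𝓘(ℝ, E) x) (c : ℝ → M) (a : ℝ → E) (τ₀ : ℝ) :
    Prop :=
  HasDerivAt (fun τ => chartDeriv (c τ₀) (c τ) (a τ))
    (fderiv ℝ (chartField X (c τ₀)) (extChartAt 𝓘(ℝ, E) (c τ₀) (c τ₀)) (a τ₀)) τ₀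

theorem hasDerivAt_extChartAt_comp {c : ℝ → M} {a b : ℝ} (hc : IsMIntegralCurveOn c X (Ioo a b))
    {τ₀ : ℝ} (hτ₀ : τ₀ ∈ Ioo a b) :
    HasDerivAt (fun τ => extChartAt 𝓘(ℝ, E) (c τ₀) (c τ)) (fieldE X (c τ₀)) τ₀ := by
  have h1 := (hc τ₀ hτ₀).hasMFDerivAt (Ioo_mem_nhds hτ₀.1 hτ₀.2)
  let L : ℝ →L[ℝ] E := ContinuousLinearMap.toSpanSingleton ℝ (fieldE X (c τ₀))
  have h2 : HasMFDerivAt 𝓘(ℝ, ℝ) 𝓘(ℝ, E) (fun τ => extChartAt 𝓘(ℝ, E) (c τ₀) (c τ)) τ₀ L := by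
    refine (HasMFDerivAt.comp τ₀ (hasMFDerivAt_chart
      (mem_extChartAt_source (c τ₀))) h1).congr_mfderiv ?_
    rw [chartDeriv_self]
    rfl
  exact h2.hasFDerivAt

/-- A field commuting with `X` is invariant under the flow of `X`. -/
theorem lieTransportedAt_field [CompleteSpace E] {V : (x : M) → TangentSpace 𝓘(ℝ, E) x}
    (hV : IsSmoothField V) (hcomm : ∀ x, VectorField.mlieBracket 𝓘(ℝ, E) X V x = 0) {c : ℝ → M}
    {a b : ℝ} (hc : IsMIntegralCurveOn c X (Ioo a b)) {τ₀ : ℝ} (hτ₀ : τ₀ ∈ Ioo a b) :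
    LieTransportedAt X c (fun τ => fieldE V (c τ)) τ₀ := by
  have hcd := hasDerivAt_extChartAt_comp hc hτ₀
  have h1 := (hV.hasFDerivAt_chartField (c τ₀)).comp_hasDerivAt τ₀ hcd
  -- The chain rule gives `DV(X)`; commutation turns it into `DX(V)`, the right side of the
  -- linearized equation.
  rw [fderiv_chartField_comm (hcomm _)] at h1
  refine h1.congr_of_eventuallyEq ?_
  have hcont : ContinuousAt c τ₀ :=
    (hc.continuousWithinAt hτ₀).continuousAt (Ioo_mem_nhds hτ₀.1 hτ₀.2)
  filter_upwards [hcont (extChartAt_source_mem_nhds (I := 𝓘(ℝ, E)) (c τ₀))] with τ hτ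
  exact (chartField_extChartAt V hτ).symm

variable [T2Space M]

/-- Integral curves with the same initial point agree on the common interval, `M` being Hausdorff.
Hence the choice in `flow` is immaterial. -/
theorem FlowsTo.unique (hX : IsSmoothField X) {s : ℝ} {p q q' : M} (h : FlowsTo X s p q)
    (h' : FlowsTo X s p q') : q = q' := by
  have : IsManifold 𝓘(ℝ, E) 1 M := isManifold_one
  obtain ⟨a, b, c, h0, hs, hc, hc0, rfl⟩ := h
  obtain ⟨a', b', c', h0', hs', hc', hc0', rfl⟩ := h'
  refine isMIntegralCurveOn_Ioo_eqOn_of_contMDiff_boundaryless (t₀ := 0) (a := max a a')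
    (b := min b b') ⟨max_lt h0.1 h0'.1, lt_min h0.2 h0'.2⟩ (hX.of_le (by simp))
    (hc.mono (Ioo_subset_Ioo (le_max_left _ _) (min_le_left _ _)))
    (hc'.mono (Ioo_subset_Ioo (le_max_right _ _) (min_le_right _ _))) (hc0.trans hc0'.symm)
    ⟨max_lt hs.1 hs'.1, lt_min hs.2 hs'.2⟩

theorem FlowsTo.flow_eq (hX : IsSmoothField X) {s : ℝ} {p q : M} (h : FlowsTo X s p q) :
    flow X s p = q := by
  have hex : ∃ q, FlowsTo X s p q := ⟨q, h⟩
  rw [flow, dif_pos hex]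
  exact hex.choose_spec.unique hX h

/-- The second integral curve, shifted by `s`, is glued to the first: their intervals overlap around
`s`. -/
theorem FlowsTo.add (hX : IsSmoothField X) {s t : ℝ} {p q r : M} (h : FlowsTo X s p q)
    (h' : FlowsTo X t q r) : FlowsTo X (s + t) p r := by
  classical
  have : IsManifold 𝓘(ℝ, E) 1 M := isManifold_one
  obtain ⟨a, b, c, h0, hs, hc, rfl, rfl⟩ := h
  obtain ⟨a', b', c', h0', ht, hc', hc0', rfl⟩ := h'
  have hX1 : ContMDiff 𝓘(ℝ, E) (𝓘(ℝ, E).prod 𝓘(ℝ, E)) 1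
    (fun x => (⟨x, X x⟩ : TangentBundle 𝓘(ℝ, E) M)) := hX.of_le (by simp)
  have hd : IsMIntegralCurveOn (c' ∘ (· - s)) X (Ioo (a' + s) (b' + s)) := by
    refine (isMIntegralCurveOn_comp_sub.2 hc').mono fun x hx => ?_
    exact ⟨by linarith [hx.1], by linarith [hx.2]⟩
  have hmem : s ∈ Ioo a b ∩ Ioo (a' + s) (b' + s) :=
    ⟨hs, by linarith [h0'.1], by linarith [h0'.2]⟩
  have hglue : c s = (c' ∘ (· - s)) s := by simp [hc0']
  have hpw := isMIntegralCurveOn_piecewise hX1 hc hd hmem hglue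
  rw [Ioo_union_Ioo' (hmem.2.1.trans hmem.1.2) (hmem.1.1.trans hmem.2.2)] at hpw
  refine ⟨_, _, _, ?_, ?_, hpw, piecewise_eq_of_mem _ _ _ h0, ?_⟩
  · exact ⟨min_lt_of_left_lt h0.1, lt_max_of_lt_left h0.2⟩
  · exact ⟨min_lt_of_right_lt (by linarith [ht.1]), lt_max_of_lt_right (by linarith [ht.2])⟩
  · have := eqOn_piecewise_of_isMIntegralCurveOn_Ioo hX1 hc hd hmem hglue
      (show s + t ∈ Ioo (a' + s) (b' + s) from ⟨by linarith [ht.1], by linarith [ht.2]⟩)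
    simpa using this

/-- The time-`τ` map of the flow of `X` is defined near `p`, and `C²` at `p`. -/
def FlowRegularAt (X : (x : M) → TangentSpace 𝓘(ℝ, E) x) (τ : ℝ) (p : M) : Prop :=
  (∀ᶠ y in 𝓝 p, y ∈ flowDomain X τ) ∧ ContMDiffAt 𝓘(ℝ, E) 𝓘(ℝ, E) 2 (flow X τ) p

theorem flowsTo_flow (hX : IsSmoothField X) {s : ℝ} {p : M} (h : p ∈ flowDomain X s) :
    FlowsTo X s p (flow X s p) := by
  obtain ⟨q, hq⟩ := h
  rwa [hq.flow_eq hX]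

/-- The group law `Φ_τ = Φ_(τ-σ) ∘ Φ_σ`, valid near `p`, transfers regularity from time `σ` to time
`τ`. -/
theorem FlowRegularAt.extend (hX : IsSmoothField X) {σ τ : ℝ} {p : M} {Φ : M → M} {N : Set M}
    (h : FlowRegularAt X σ p) (hN : IsOpen N) (hp : flow X σ p ∈ N)
    (hΦ : ∀ y ∈ N, FlowsTo X (τ - σ) y (Φ y)) (hs : ContMDiffOn 𝓘(ℝ, E) 𝓘(ℝ, E) 2 Φ N) :
    FlowRegularAt X τ p ∧ flow X τ =ᶠ[𝓝 p] Φ ∘ flow X σ := by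
  have h1 : ∀ᶠ y in 𝓝 p, FlowsTo X τ y (Φ (flow X σ y)) := by
    filter_upwards [h.1, h.2.continuousAt (hN.mem_nhds hp)] with y hy hyN
    simpa using (flowsTo_flow hX hy).add hX (hΦ _ hyN)
  have h2 : flow X τ =ᶠ[𝓝 p] Φ ∘ flow X σ := h1.mono fun y hy => hy.flow_eq hX
  refine ⟨⟨h1.mono fun y hy => ⟨_, hy⟩, ?_⟩, h2⟩
  exact ((hs.contMDiffAt (hN.mem_nhds hp)).comp p h.2).congr_of_eventuallyEq h2

theorem flow_eq_of_isMIntegralCurveOn (hX : IsSmoothField X) {c : ℝ → M} {a b : ℝ}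
    (hc : IsMIntegralCurveOn c X (Ioo a b)) (h0 : (0 : ℝ) ∈ Ioo a b) {τ : ℝ} (hτ : τ ∈ Ioo a b) :
    flow X τ (c 0) = c τ :=
  (IsMIntegralCurveOn.flowsTo hc h0 hτ).flow_eq hX

theorem flow_zero_eventuallyEq [CompleteSpace E] (hX : IsSmoothField X) (p : M) :
    FlowRegularAt X 0 p ∧ flow X 0 =ᶠ[𝓝 p] id := by
  obtain ⟨Φ, ε, N, hε, hN, hp, h0, hc, -, -⟩ := exists_local_flow hX p
  have h1 : ∀ᶠ y in 𝓝 p, FlowsTo X 0 y y := by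
    filter_upwards [hN.mem_nhds hp] with y hy
    have hm : (0 : ℝ) ∈ Ioo (-ε) ε := ⟨by linarith, hε⟩
    simpa [h0 y hy] using IsMIntegralCurveOn.flowsTo (hc y hy) hm hm
  have h2 : flow X 0 =ᶠ[𝓝 p] id := h1.mono fun y hy => hy.flow_eq hX
  exact ⟨⟨h1.mono fun y hy => ⟨_, hy⟩, contMDiffAt_id.congr_of_eventuallyEq h2⟩, h2⟩

/-- The regular times contain `0` and are open and relatively closed in the connected interval. -/
theorem flowRegularAt_of_isMIntegralCurveOn [CompleteSpace E] (hX : IsSmoothField X) {c : ℝ → M}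
    {a b : ℝ} (hc : IsMIntegralCurveOn c X (Ioo a b)) (h0 : (0 : ℝ) ∈ Ioo a b) :
    ∀ τ ∈ Ioo a b, FlowRegularAt X τ (c 0) := by
  suffices H : Ioo a b ⊆ {τ | τ ∈ Ioo a b ∧ FlowRegularAt X τ (c 0)} from fun τ hτ => (H hτ).2
  -- One `ε` serves all `σ` near `τ₀`. Openness uses it with `σ = τ₀`, closedness with `σ` a nearby
  -- regular time and `τ = τ₀`.
  have key : ∀ τ₀ ∈ Ioo a b, ∃ ε > 0, ∀ᶠ σ in 𝓝 τ₀, FlowRegularAt X σ (c 0) →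
      ∀ τ, |τ - σ| < ε → FlowRegularAt X τ (c 0) := by
    intro τ₀ hτ₀
    obtain ⟨Φ, ε, N, hε, hN, hx, hflow, hs, -⟩ := exists_local_flow_flowsTo hX (c τ₀)
    have hcont : ContinuousAt c τ₀ :=
      (hc.continuousWithinAt hτ₀).continuousAt (Ioo_mem_nhds hτ₀.1 hτ₀.2)
    refine ⟨ε, hε, ?_⟩
    filter_upwards [hcont (hN.mem_nhds hx), Ioo_mem_nhds hτ₀.1 hτ₀.2] with σ hσN hσ hreg τ hτ
    rw [abs_lt] at hτ
    exact (hreg.extend hX hN (by rwa [flow_eq_of_isMIntegralCurveOn hX hc h0 hσ])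
      (fun y hy => hflow y hy _ hτ) (hs _ hτ)).1
  refine isPreconnected_Ioo.subset_of_closure_inter_subset ?_
    ⟨0, h0, h0, (flow_zero_eventuallyEq hX (c 0)).1⟩ ?_
  · rw [isOpen_iff_mem_nhds]
    rintro τ₀ ⟨hτ₀, hreg⟩
    obtain ⟨ε, hε, hev⟩ := key τ₀ hτ₀
    filter_upwards [Ioo_mem_nhds hτ₀.1 hτ₀.2, Metric.ball_mem_nhds τ₀ hε] with τ hτ hτε
    exact ⟨hτ, hev.self_of_nhds hreg τ (by simpa [Real.dist_eq] using hτε)⟩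
  · rintro τ₀ ⟨hcl, hτ₀⟩
    obtain ⟨ε, hε, hev⟩ := key τ₀ hτ₀
    obtain ⟨σ, ⟨hσ, hσε⟩, hσmem⟩ := mem_closure_iff_nhds.1 hcl _
      (Filter.inter_mem hev (Metric.ball_mem_nhds τ₀ hε))
    refine ⟨hτ₀, hσ hσmem.2 τ₀ ?_⟩
    rw [Metric.mem_ball, dist_comm, Real.dist_eq] at hσε
    exact hσε

/-- Factoring `Φ_τ` as a local flow for time `τ - τ₀` after `Φ_τ₀` reduces the claim to the
linearized equation at time `0` at the centre `c τ₀`. -/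
theorem lieTransportedAt_mapDeriv_flow [CompleteSpace E] (hX : IsSmoothField X) {c : ℝ → M}
    {a b : ℝ} (hc : IsMIntegralCurveOn c X (Ioo a b)) (h0 : (0 : ℝ) ∈ Ioo a b) (u : E)
    {τ₀ : ℝ} (hτ₀ : τ₀ ∈ Ioo a b) :
    LieTransportedAt X c (fun τ => mapDeriv (flow X τ) (c 0) u) τ₀ := by
  obtain ⟨Φ, ε, N, hε, hN, hx, hflow, hs, hd⟩ := exists_local_flow_flowsTo hX (c τ₀)
  have hreg := flowRegularAt_of_isMIntegralCurveOn hX hc h0 τ₀ hτ₀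
  have hc₀ := flow_eq_of_isMIntegralCurveOn hX hc h0 hτ₀
  have h1 := HasDerivAt.scomp τ₀ (h := fun τ => τ - τ₀)
    (by simpa using hd (mapDeriv (flow X τ₀) (c 0) u))
    ((hasDerivAt_id τ₀).sub_const τ₀)
  rw [one_smul] at h1
  refine h1.congr_of_eventuallyEq ?_
  filter_upwards [Ioo_mem_nhds hτ₀.1 hτ₀.2, Metric.ball_mem_nhds τ₀ hε] with τ hτ hτε
  rw [Metric.mem_ball, Real.dist_eq, abs_lt] at hτε
  have hN₀ : flow X τ₀ (c 0) ∈ N := by rwa [hc₀]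
  have h2 := (hreg.extend hX hN hN₀ (fun y hy => hflow y hy _ hτε) (hs _ hτε)).2
  have h3 : c τ = Φ (τ - τ₀) (c τ₀) := by
    rw [← flow_eq_of_isMIntegralCurveOn hX hc h0 hτ, h2.self_of_nhds, Function.comp_apply, hc₀]
  have h4 : mapDeriv (flow X τ) (c 0) = (mapDeriv (Φ (τ - τ₀)) (c τ₀)).comp
      (mapDeriv (flow X τ₀) (c 0) : E →L[ℝ] E) := by
    rw [mapDeriv_congr h2, mapDeriv_comp, hc₀]
    · exact ((hs _ hτε).contMDiffAt (hN.mem_nhds hN₀)).mdifferentiableAt (by simp)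
    · exact hreg.2.mdifferentiableAt (by simp)
  simp only [Function.comp_apply, h4, ← h3]
  rfl

end GlobalFlow

/-! ### Killing flows preserve the metric and commuting fields -/

section KillingFlow

open Set

variable {E : Type*} [NormedAddCommGroup E] [NormedSpace ℝ E] [FiniteDimensional ℝ E]
  {M : Type*} [TopologicalSpace M] [ChartedSpace E M] [IsManifold 𝓘(ℝ, E) ∞ M]
  {X V : (x : M) → TangentSpace 𝓘(ℝ, E) x} {g : Metric E M}

/-- In the chart centred at `c τ₀` the product rule yields the three terms of the Lie derivative of
`g` along `X`, whose sum vanishes. -/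
theorem IsKilling.hasDerivAt_innerE (hK : IsKilling g X) {c : ℝ → M} {a b : ℝ}
    (hc : IsMIntegralCurveOn c X (Ioo a b)) {v w : ℝ → E} {τ₀ : ℝ} (hτ₀ : τ₀ ∈ Ioo a b)
    (hv : LieTransportedAt X c v τ₀) (hw : LieTransportedAt X c w τ₀) :
    HasDerivAt (fun τ => innerE g (c τ) (v τ) (w τ)) 0 τ₀ := by
  have hcd := hasDerivAt_extChartAt_comp hc hτ₀
  have h1 : HasDerivAt (fun τ => chartMetric g (c τ₀) (extChartAt 𝓘(ℝ, E) (c τ₀) (c τ)))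
      (fderiv ℝ (chartMetric g (c τ₀)) (extChartAt 𝓘(ℝ, E) (c τ₀) (c τ₀)) (fieldE X (c τ₀))) τ₀ :=
    HasFDerivAt.comp_hasDerivAt (l := chartMetric g (c τ₀)) τ₀
      (differentiableAt_chartMetric g (c τ₀)).hasFDerivAt hcd
  have h2 := (h1.clm_apply hv).clm_apply hw
  have hz := hK.chart_eq_zero (c τ₀) (v τ₀) (w τ₀)
  simp only [chartDeriv_self, ContinuousLinearMap.id_apply, chartMetric_self,
    _root_.add_apply] at h2
  rw [hz] at h2
  refine h2.congr_of_eventuallyEq ?_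
  have hcont : ContinuousAt c τ₀ :=
    (hc.continuousWithinAt hτ₀).continuousAt (Ioo_mem_nhds hτ₀.1 hτ₀.2)
  filter_upwards [hcont (extChartAt_source_mem_nhds (I := 𝓘(ℝ, E)) (c τ₀))] with τ hτ
  exact innerE_eq_chartMetric g hτ _ _

theorem IsKilling.innerE_eq (hK : IsKilling g X) {c : ℝ → M} {a b : ℝ}
    (hc : IsMIntegralCurveOn c X (Ioo a b)) {v w : ℝ → E}
    (hv : ∀ τ ∈ Ioo a b, LieTransportedAt X c v τ)
    (hw : ∀ τ ∈ Ioo a b, LieTransportedAt X c w τ) {σ τ : ℝ} (hσ : σ ∈ Ioo a b)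
    (hτ : τ ∈ Ioo a b) :
    innerE g (c σ) (v σ) (w σ) = innerE g (c τ) (v τ) (w τ) := by
  have hd : ∀ τ ∈ Ioo a b, HasDerivAt (fun τ => innerE g (c τ) (v τ) (w τ)) 0 τ :=
    fun τ hτ => hK.hasDerivAt_innerE hc hτ (hv τ hτ) (hw τ hτ)
  exact isOpen_Ioo.is_const_of_deriv_eq_zero isPreconnected_Ioo
    (fun τ hτ => (hd τ hτ).differentiableAt.differentiableWithinAt)
    (fun τ hτ => (hd τ hτ).deriv) hσ hτ

/-- `Φ` preserves the metric `g` at the point `p`. -/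
def IsIsometricAt (g : Metric E M) (Φ : M → M) (p : M) : Prop :=
  ∀ u w : E, innerE g (Φ p) (mapDeriv Φ p u) (mapDeriv Φ p w) = innerE g p u w

omit [FiniteDimensional ℝ E] in
theorem IsIsometricAt.injective {Φ : M → M} {p : M} (h : IsIsometricAt g Φ p) :
    Function.Injective (mapDeriv Φ p : E →L[ℝ] E) := by
  refine (injective_iff_map_eq_zero _).2 fun u hu => ?_
  by_contra hne
  have := h u u
  rw [hu, map_zero] at this
  exact (innerE_pos g p hne).ne this

theorem IsIsometricAt.surjective {Φ : M → M} {p : M} (h : IsIsometricAt g Φ p) :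
    Function.Surjective (mapDeriv Φ p : E →L[ℝ] E) :=
  LinearMap.surjective_of_injective (f := ((mapDeriv Φ p : E →L[ℝ] E) : E →ₗ[ℝ] E)) h.injective

/-- A tangent vector is determined by its products with the vectors `mapDeriv Φ p u`. -/
theorem IsIsometricAt.ext {Φ : M → M} {p : M} (h : IsIsometricAt g Φ p) {y z : E}
    (hyz : ∀ u, innerE g (Φ p) y (mapDeriv Φ p u) = innerE g (Φ p) z (mapDeriv Φ p u)) :
    y = z := by
  by_contra hne
  obtain ⟨u, hu⟩ := h.surjective (y - z)
  have h1 := hyz u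
  have h2 := innerE_pos g (Φ p) (sub_ne_zero.2 hne)
  rw [hu] at h1
  rw [map_sub (innerE g (Φ p)), _root_.sub_apply, h1, sub_self] at h2
  exact h2.false

variable [T2Space M]

/-- The flow of a Killing field is isometric. -/
theorem IsKilling.isIsometricAt_flow (hX : IsSmoothField X) (hK : IsKilling g X) {s : ℝ} {p : M}
    (hp : p ∈ flowDomain X s) : IsIsometricAt g (flow X s) p := by
  have : CompleteSpace E := FiniteDimensional.complete ℝ E
  intro u w
  obtain ⟨q, a, b, c, h0, hs, hc, rfl, rfl⟩ := hp
  have h := hK.innerE_eq hc (fun τ hτ => lieTransportedAt_mapDeriv_flow hX hc h0 u hτ)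
    (fun τ hτ => lieTransportedAt_mapDeriv_flow hX hc h0 w hτ) hs h0
  have hid : mapDeriv (flow X 0) (c 0) = ContinuousLinearMap.id ℝ E := by
    rw [mapDeriv_congr (flow_zero_eventuallyEq hX (c 0)).2, mapDeriv_id]
  simp only [hid, ContinuousLinearMap.id_apply] at h
  rw [flow_eq_of_isMIntegralCurveOn hX hc h0 hs]
  exact h

/-- The flow of a Killing field `X` preserves the fields which commute with `X`. -/
theorem IsKilling.mapDeriv_flow_field (hX : IsSmoothField X) (hV : IsSmoothField V)
    (hK : IsKilling g X) (hcomm : ∀ x, VectorField.mlieBracket 𝓘(ℝ, E) X V x = 0) {s : ℝ} {p : M}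
    (hp : p ∈ flowDomain X s) :
    mapDeriv (flow X s) p (fieldE V p) = fieldE V (flow X s p) := by
  have : CompleteSpace E := FiniteDimensional.complete ℝ E
  have hiso := hK.isIsometricAt_flow hX hp
  -- Testing against `dΦ_s u` replaces uniqueness for the linearized equation: `g(dΦ_s V, dΦ_s u) =
  -- g(V, u)` by isometry, and `g(V, dΦ_τ u)` is constant in `τ`.
  refine hiso.ext fun u => ?_
  rw [hiso]
  obtain ⟨q, a, b, c, h0, hs, hc, rfl, rfl⟩ := hp
  have h := hK.innerE_eq hc (fun τ hτ => lieTransportedAt_field hV hcomm hc hτ)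
    (fun τ hτ => lieTransportedAt_mapDeriv_flow hX hc h0 u hτ) h0 hs
  have hid : mapDeriv (flow X 0) (c 0) = ContinuousLinearMap.id ℝ E := by
    rw [mapDeriv_congr (flow_zero_eventuallyEq hX (c 0)).2, mapDeriv_id]
  simp only [hid, ContinuousLinearMap.id_apply] at h
  rw [flow_eq_of_isMIntegralCurveOn hX hc h0 hs]
  exact h

end KillingFlow

/-! ### Pullback of a metric and second derivatives, in a vector space -/

section Isometries

variable {E : Type*} [NormedAddCommGroup E] [NormedSpace ℝ E]

/-- The Christoffel symbols of the first kind of the pullback of a metric. -/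
theorem christoffel_pullback {G G' : E → E →L[ℝ] E →L[ℝ] ℝ} {f : E → E} {x : E}
    (hf : ContDiffAt ℝ 2 f x) (hG' : DifferentiableAt ℝ G' (f x))
    (hsymm : ∀ u v, G' (f x) u v = G' (f x) v u)
    (hG : DifferentiableAt ℝ G x)
    (h : ∀ᶠ y in 𝓝 x, ∀ u v, G y u v = G' (f y) (fderiv ℝ f y u) (fderiv ℝ f y v)) (u v w : E) :
    1 / 2 * (fderiv ℝ G x u v w + fderiv ℝ G x v u w - fderiv ℝ G x w u v) =
      1 / 2 * (fderiv ℝ G' (f x) (fderiv ℝ f x u) (fderiv ℝ f x v) (fderiv ℝ f x w) +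
        fderiv ℝ G' (f x) (fderiv ℝ f x v) (fderiv ℝ f x u) (fderiv ℝ f x w) -
        fderiv ℝ G' (f x) (fderiv ℝ f x w) (fderiv ℝ f x u) (fderiv ℝ f x v)) +
      G' (f x) (fderiv ℝ (fderiv ℝ f) x u v) (fderiv ℝ f x w) := by
  have hD2 : ∀ a b, fderiv ℝ (fderiv ℝ f) x a b = fderiv ℝ (fderiv ℝ f) x b a :=
    hf.isSymmSndFDerivAt (by simp)
  have hf1 : HasFDerivAt f (fderiv ℝ f x) x := (hf.differentiableAt (by simp)).hasFDerivAt
  have hf2 : HasFDerivAt (fderiv ℝ f) (fderiv ℝ (fderiv ℝ f) x) x :=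
    ((hf.fderiv_right (m := 1) (by norm_num)).differentiableAt (by simp)).hasFDerivAt
  have key : ∀ a b c, fderiv ℝ G x a b c =
      fderiv ℝ G' (f x) (fderiv ℝ f x a) (fderiv ℝ f x b) (fderiv ℝ f x c) +
        G' (f x) (fderiv ℝ (fderiv ℝ f) x a b) (fderiv ℝ f x c) +
        G' (f x) (fderiv ℝ f x b) (fderiv ℝ (fderiv ℝ f) x a c) := by
    intro a b c
    have h1 := (hG.hasFDerivAt.clm_apply (hasFDerivAt_const b x)).clm_apply (hasFDerivAt_const c x)
    have hGf : HasFDerivAt (fun y => G' (f y)) ((fderiv ℝ G' (f x)).comp (fderiv ℝ f x)) x :=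
      HasFDerivAt.comp (g := G') x hG'.hasFDerivAt hf1
    have hb := hf2.clm_apply (hasFDerivAt_const b x)
    have hc := hf2.clm_apply (hasFDerivAt_const c x)
    have hGb := hGf.clm_apply hb
    have h2 := hGb.clm_apply hc
    have h3 := h1.unique (h2.congr_of_eventuallyEq (h.mono fun y hy => hy b c))
    have h4 := DFunLike.congr_fun h3 a
    simp at h4
    linarith
  -- Of the six terms with a second derivative of `f`, symmetry cancels four and makes the other two
  -- equal, which absorbs the factor `1 / 2`.
  rw [key u v w, key v u w, key w u v, hD2 v u, hD2 w u, hD2 w v, hsymm (fderiv ℝ f x v),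
    hsymm (fderiv ℝ f x u)]
  ring

/-- The second derivative of the image of a curve. -/
theorem deriv_deriv_comp {f : E → E} {β : ℝ → E} {t : ℝ} (hf : ContDiffAt ℝ 2 f (β t))
    (hβ : ContDiffAt ℝ 2 β t) :
    deriv (fun τ => f (β τ)) t = fderiv ℝ f (β t) (deriv β t) ∧
    deriv (deriv fun τ => f (β τ)) t = fderiv ℝ (fderiv ℝ f) (β t) (deriv β t) (deriv β t) +
      fderiv ℝ f (β t) (deriv (deriv β) t) := by
  have h1 : ∀ᶠ τ in 𝓝 t, deriv (fun τ => f (β τ)) τ = fderiv ℝ f (β τ) (deriv β τ) := by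
    filter_upwards [hβ.continuousAt.eventually (hf.eventually (by simp)),
      hβ.eventually (by simp)] with τ h1 h2
    exact ((h1.differentiableAt (by simp)).hasFDerivAt.comp_hasDerivAt τ
      (h2.differentiableAt (by simp)).hasDerivAt).deriv
  refine ⟨h1.self_of_nhds, ?_⟩
  have hf2 : HasFDerivAt (fderiv ℝ f) (fderiv ℝ (fderiv ℝ f) (β t)) (β t) :=
    ((hf.fderiv_right (m := 1) (by norm_num)).differentiableAt (by simp)).hasFDerivAt
  have hβ1 := (hβ.differentiableAt (by simp)).hasDerivAt
  have hβ2 : HasDerivAt (deriv β) (deriv (deriv β) t) t :=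
    ((hβ.derivWithin (m := 1) (by norm_num)).differentiableAt (by simp)).hasDerivAt
  rw [Filter.EventuallyEq.deriv_eq h1]
  exact ((hf2.comp_hasDerivAt t hβ1).clm_apply hβ2).deriv

end Isometries

/-! ### Isometries carry accelerations to accelerations -/

section IsometricImages

variable {E : Type*} [NormedAddCommGroup E] [NormedSpace ℝ E]
  {M : Type*} [TopologicalSpace M] [ChartedSpace E M]

/-- A map `M → M` in the preferred charts around `p` and `Φ p`. -/
def chartMap (Φ : M → M) (p : M) (q : E) : E :=
  extChartAt 𝓘(ℝ, E) (Φ p) (Φ ((extChartAt 𝓘(ℝ, E) p).symm q))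

theorem chartMap_self (Φ : M → M) (p : M) :
    chartMap Φ p (extChartAt 𝓘(ℝ, E) p p) = extChartAt 𝓘(ℝ, E) (Φ p) (Φ p) := by
  rw [chartMap, extChartAt_to_inv]

theorem contDiffAt_chartMap {Φ : M → M} {p : M}
    (h : ContMDiffAt 𝓘(ℝ, E) 𝓘(ℝ, E) 2 Φ p) :
    ContDiffAt ℝ 2 (chartMap Φ p) (extChartAt 𝓘(ℝ, E) p p) := by
  have := (contMDiffAt_iff.1 h).2
  rwa [ModelWithCorners.range_eq_univ, contDiffWithinAt_univ] at this

theorem contDiffAt_chart_comp {γ : ℝ → M} {t : ℝ} (hγ : ContMDiffAt 𝓘(ℝ, ℝ) 𝓘(ℝ, E) 2 γ t) :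
    ContDiffAt ℝ 2 (fun σ => extChartAt 𝓘(ℝ, E) (γ t) (γ σ)) t := by
  have := (contMDiffAt_iff.1 hγ).2
  rw [ModelWithCorners.range_eq_univ, contDiffWithinAt_univ] at this
  exact this

/-- The velocity of a curve, as an element of the copy `E` of the tangent space. -/
def velocityE (γ : ℝ → M) (t : ℝ) : E := velocity (E := E) γ t

theorem velocityE_eq {γ : ℝ → M} {t : ℝ} {v : ℝ →L[ℝ] E}
    (h : HasMFDerivAt 𝓘(ℝ, ℝ) 𝓘(ℝ, E) γ t v) : velocityE γ t = v 1 := by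
  have h1 : mfderiv 𝓘(ℝ, ℝ) 𝓘(ℝ, E) γ t = v := h.mfderiv
  exact DFunLike.congr_fun h1 (1 : ℝ)

/-- The derivative of a curve, as a linear map into the copy `E` of the tangent space. -/
def velocityMap (γ : ℝ → M) (t : ℝ) : ℝ →L[ℝ] E :=
  ContinuousLinearMap.toSpanSingleton ℝ (velocityE γ t)

theorem hasMFDerivAt_velocityMap {γ : ℝ → M} {t : ℝ}
    (h : MDifferentiableAt 𝓘(ℝ, ℝ) 𝓘(ℝ, E) γ t) :
    HasMFDerivAt 𝓘(ℝ, ℝ) 𝓘(ℝ, E) γ t (velocityMap (E := E) γ t) := by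
  refine h.hasMFDerivAt.congr_mfderiv ?_
  refine ContinuousLinearMap.ext_ring ?_
  exact (one_smul ℝ (velocityE (E := E) γ t)).symm

theorem velocityE_comp {Φ : M → M} {γ : ℝ → M} {t : ℝ}
    (hΦ : MDifferentiableAt 𝓘(ℝ, E) 𝓘(ℝ, E) Φ (γ t))
    (hγ : MDifferentiableAt 𝓘(ℝ, ℝ) 𝓘(ℝ, E) γ t) :
    velocityE (E := E) (fun τ => Φ (γ τ)) t = mapDeriv Φ (γ t) (velocityE γ t) := by
  have h := HasMFDerivAt.comp t (hasMFDerivAt_mapDeriv hΦ) (hasMFDerivAt_velocityMap hγ)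
  refine (velocityE_eq h).trans ?_
  exact congrArg (mapDeriv Φ (γ t) : E →L[ℝ] E) (one_smul ℝ (velocityE γ t))

variable [IsManifold 𝓘(ℝ, E) ∞ M]

theorem hasDerivAt_chart_comp {γ : ℝ → M} {x : M} {t : ℝ}
    (hγ : MDifferentiableAt 𝓘(ℝ, ℝ) 𝓘(ℝ, E) γ t) (ht : γ t ∈ (extChartAt 𝓘(ℝ, E) x).source) :
    HasDerivAt (fun τ => extChartAt 𝓘(ℝ, E) x (γ τ)) (chartDeriv x (γ t) (velocityE γ t)) t := by
  let L : ℝ →L[ℝ] E :=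
    ContinuousLinearMap.toSpanSingleton ℝ (chartDeriv x (γ t) (velocityE γ t))
  have h2 : HasMFDerivAt 𝓘(ℝ, ℝ) 𝓘(ℝ, E) (fun τ => extChartAt 𝓘(ℝ, E) x (γ τ)) t L := by
    refine (HasMFDerivAt.comp t (hasMFDerivAt_chart ht)
      (hasMFDerivAt_velocityMap hγ)).congr_mfderiv ?_
    refine ContinuousLinearMap.ext_ring ?_
    exact (congrArg (chartDeriv x (γ t) : E →L[ℝ] E) (one_smul ℝ (velocityE γ t))).trans
      (one_smul ℝ (chartDeriv x (γ t) (velocityE γ t))).symm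
  exact h2.hasFDerivAt

/-- The Levi-Civita acceleration of a curve, as an element of the copy `E` of the tangent space. -/
def accelerationE (g : Metric E M) (γ : ℝ → M) (t : ℝ) : E :=
  leviCivitaAlong g γ (velocity γ) t

theorem eventually_contMDiffAt {F : Type*} [NormedAddCommGroup F] [NormedSpace ℝ F]
    {N : Type*} [TopologicalSpace N] [ChartedSpace F N] [IsManifold 𝓘(ℝ, F) ∞ N] {f : N → M}
    {x : N} (h : ContMDiffAt 𝓘(ℝ, F) 𝓘(ℝ, E) 2 f x) :
    ∀ᶠ y in 𝓝 x, ContMDiffAt 𝓘(ℝ, F) 𝓘(ℝ, E) 2 f y := by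
  have : IsManifold 𝓘(ℝ, E) 2 M := inferInstance
  have : IsManifold 𝓘(ℝ, F) 2 N := inferInstance
  exact (contMDiffAt_iff_contMDiffAt_nhds (by simp)).1 h

theorem eventually_chart_velocity {γ : ℝ → M} {t : ℝ}
    (hγ : ContMDiffAt 𝓘(ℝ, ℝ) 𝓘(ℝ, E) 2 γ t) :
    ∀ᶠ τ in 𝓝 t, deriv (fun σ => extChartAt 𝓘(ℝ, E) (γ t) (γ σ)) τ =
      chartDeriv (γ t) (γ τ) (velocityE γ τ) := by
  filter_upwards [hγ.continuousAt (extChartAt_source_mem_nhds (I := 𝓘(ℝ, E)) (γ t)),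
    eventually_contMDiffAt hγ] with τ h1 h2
  exact (hasDerivAt_chart_comp (h2.mdifferentiableAt (by simp)) h1).deriv

theorem velocityE_eq_deriv {γ : ℝ → M} {t : ℝ} (hγ : ContMDiffAt 𝓘(ℝ, ℝ) 𝓘(ℝ, E) 2 γ t) :
    velocityE γ t = deriv (fun σ => extChartAt 𝓘(ℝ, E) (γ t) (γ σ)) t := by
  rw [(eventually_chart_velocity hγ).self_of_nhds, chartDeriv_self, ContinuousLinearMap.id_apply]

/-- Near `t` the chart components of the velocity are the derivatives of the coordinates, so
differentiating them gives a second derivative. -/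
theorem accelerationE_eq (g : Metric E M) {γ : ℝ → M} {t : ℝ}
    (hγ : ContMDiffAt 𝓘(ℝ, ℝ) 𝓘(ℝ, E) 2 γ t) :
    accelerationE g γ t = deriv (deriv fun σ => extChartAt 𝓘(ℝ, E) (γ t) (γ σ)) t +
      christoffel g (γ t) (extChartAt 𝓘(ℝ, E) (γ t) (γ t)) (velocityE γ t) (velocityE γ t) := by
  have h : accelerationE g γ t = deriv (fun τ => chartDeriv (γ t) (γ τ) (velocityE γ τ)) t +
      christoffel g (γ t) (extChartAt 𝓘(ℝ, E) (γ t) (γ t)) (velocityE γ t) (velocityE γ t) := rfl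
  rw [h, Filter.EventuallyEq.deriv_eq (eventually_chart_velocity hγ)]

theorem eventually_fderiv_chartMap {Φ : M → M} {p : M}
    (h : ContMDiffAt 𝓘(ℝ, E) 𝓘(ℝ, E) 2 Φ p) :
    ∀ᶠ y in 𝓝 p, Φ y ∈ (extChartAt 𝓘(ℝ, E) (Φ p)).source ∧
      fderiv ℝ (chartMap Φ p) (extChartAt 𝓘(ℝ, E) p y) =
        (chartDeriv (Φ p) (Φ y)).comp ((mapDeriv Φ y).comp
          (chartInvDeriv p (extChartAt 𝓘(ℝ, E) p y) : E →L[ℝ] E)) := by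
  filter_upwards [extChartAt_source_mem_nhds (I := 𝓘(ℝ, E)) p,
    h.continuousAt (extChartAt_source_mem_nhds (I := 𝓘(ℝ, E)) (Φ p)),
    eventually_contMDiffAt h] with y hy hΦy hd
  refine ⟨hΦy, ?_⟩
  have hy' := (extChartAt 𝓘(ℝ, E) p).left_inv hy
  have h1 := hasMFDerivAt_chart_symm ((extChartAt 𝓘(ℝ, E) p).map_source hy)
  have h2 : HasMFDerivAt 𝓘(ℝ, E) 𝓘(ℝ, E) Φ
      ((extChartAt 𝓘(ℝ, E) p).symm (extChartAt 𝓘(ℝ, E) p y)) (mapDeriv (E := E) Φ y) := by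
    rw [hy']
    exact hasMFDerivAt_mapDeriv (hd.mdifferentiableAt (by simp))
  have h3 : HasMFDerivAt 𝓘(ℝ, E) 𝓘(ℝ, E) (extChartAt 𝓘(ℝ, E) (Φ p))
      (Φ ((extChartAt 𝓘(ℝ, E) p).symm (extChartAt 𝓘(ℝ, E) p y)))
      (chartDeriv (E := E) (Φ p) (Φ y)) := by
    rw [hy']
    exact hasMFDerivAt_chart hΦy
  let L : E →L[ℝ] E := (chartDeriv (Φ p) (Φ y)).comp ((mapDeriv Φ y).comp
    (chartInvDeriv p (extChartAt 𝓘(ℝ, E) p y) : E →L[ℝ] E))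
  have h4 : HasMFDerivAt 𝓘(ℝ, E) 𝓘(ℝ, E) (chartMap Φ p) (extChartAt 𝓘(ℝ, E) p y) L :=
    HasMFDerivAt.comp (extChartAt 𝓘(ℝ, E) p y) h3
      (HasMFDerivAt.comp (extChartAt 𝓘(ℝ, E) p y) h2 h1)
  have h5 : HasFDerivAt (chartMap Φ p) L (extChartAt 𝓘(ℝ, E) p y) := h4.hasFDerivAt
  exact h5.fderiv

theorem fderiv_chartMap_self {Φ : M → M} {p : M} (h : ContMDiffAt 𝓘(ℝ, E) 𝓘(ℝ, E) 2 Φ p) :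
    fderiv ℝ (chartMap Φ p) (extChartAt 𝓘(ℝ, E) p p) = mapDeriv Φ p := by
  rw [(eventually_fderiv_chartMap h).self_of_nhds.2, chartDeriv_self, chartInvDeriv_self,
    ContinuousLinearMap.comp_id, ContinuousLinearMap.id_comp]

theorem eventually_chartMetric_eq {g : Metric E M} {Φ : M → M} {p : M}
    (h : ContMDiffAt 𝓘(ℝ, E) 𝓘(ℝ, E) 2 Φ p) (hiso : ∀ᶠ y in 𝓝 p, IsIsometricAt g Φ y) :
    ∀ᶠ q in 𝓝 (extChartAt 𝓘(ℝ, E) p p), ∀ u v : E, chartMetric g p q u v =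
      chartMetric g (Φ p) (chartMap Φ p q) (fderiv ℝ (chartMap Φ p) q u)
        (fderiv ℝ (chartMap Φ p) q v) := by
  have hc : Filter.Tendsto (extChartAt 𝓘(ℝ, E) p).symm (𝓝 (extChartAt 𝓘(ℝ, E) p p)) (𝓝 p) := by
    simpa [extChartAt_to_inv] using (continuousAt_extChartAt_symm (I := 𝓘(ℝ, E)) p).tendsto
  filter_upwards [extChartAt_target_mem_nhds (I := 𝓘(ℝ, E)) p, hc.eventually hiso,
    hc.eventually (eventually_fderiv_chartMap h)] with q hq hi hd u v
  have hqs := (extChartAt 𝓘(ℝ, E) p).right_inv hq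
  rw [hqs] at hd
  rw [chartMetric_apply, ← hi, innerE_eq_chartMetric g hd.1, hd.2]
  rfl

/-- Paired with `dΦ w`, both sides become first-kind symbols, and `christoffel_pullback` compares
these; its inhomogeneous term is the second derivative of the chart map. -/
theorem IsIsometricAt.mapDeriv_christoffel [FiniteDimensional ℝ E] {g : Metric E M} {Φ : M → M}
    {p : M} (h : ContMDiffAt 𝓘(ℝ, E) 𝓘(ℝ, E) 2 Φ p) (hiso : ∀ᶠ y in 𝓝 p, IsIsometricAt g Φ y)
    (u v : E) :
    mapDeriv Φ p (christoffel g p (extChartAt 𝓘(ℝ, E) p p) u v) =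
      christoffel g (Φ p) (extChartAt 𝓘(ℝ, E) (Φ p) (Φ p)) (mapDeriv Φ p u) (mapDeriv Φ p v) +
        fderiv ℝ (fderiv ℝ (chartMap Φ p)) (extChartAt 𝓘(ℝ, E) p p) u v := by
  refine hiso.self_of_nhds.ext fun w => ?_
  have hpull := christoffel_pullback (contDiffAt_chartMap h)
    (by rw [chartMap_self]; exact differentiableAt_chartMetric g (Φ p))
    (fun a b => chartMetric_symm g (Φ p) _ a b) (differentiableAt_chartMetric g p)
    (eventually_chartMetric_eq h hiso) u v w
  rw [chartMap_self, fderiv_chartMap_self h, ← christoffelFirst_apply, ← christoffelFirst_apply,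
    chartMetric_self, ← innerE_christoffel, ← innerE_christoffel] at hpull
  rw [hiso.self_of_nhds, hpull, map_add, _root_.add_apply]

/-- Isometries map the acceleration of a curve to the acceleration of its image. -/
theorem IsIsometricAt.accelerationE_comp [FiniteDimensional ℝ E] {g : Metric E M} {Φ : M → M}
    {γ : ℝ → M} {t : ℝ} (h : ContMDiffAt 𝓘(ℝ, E) 𝓘(ℝ, E) 2 Φ (γ t))
    (hiso : ∀ᶠ y in 𝓝 (γ t), IsIsometricAt g Φ y) (hγ : ContMDiffAt 𝓘(ℝ, ℝ) 𝓘(ℝ, E) 2 γ t) :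
    accelerationE g (fun τ => Φ (γ τ)) t = mapDeriv Φ (γ t) (accelerationE g γ t) := by
  have hcomp : ContMDiffAt 𝓘(ℝ, ℝ) 𝓘(ℝ, E) 2 (fun τ => Φ (γ τ)) t := h.comp t hγ
  have hev : (fun τ => extChartAt 𝓘(ℝ, E) (Φ (γ t)) (Φ (γ τ))) =ᶠ[𝓝 t]
      fun τ => chartMap Φ (γ t) (extChartAt 𝓘(ℝ, E) (γ t) (γ τ)) := by
    filter_upwards [hγ.continuousAt (extChartAt_source_mem_nhds (I := 𝓘(ℝ, E)) (γ t))] with τ hτ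
    rw [chartMap, (extChartAt 𝓘(ℝ, E) (γ t)).left_inv hτ]
  have hdd := (deriv_deriv_comp (f := chartMap Φ (γ t)) (contDiffAt_chartMap h)
    (contDiffAt_chart_comp hγ)).2
  -- The chain rule and the Christoffel law contribute the same term `D²f(γ', γ')`, with `f` the
  -- chart map, one on each side.
  rw [accelerationE_eq g hcomp, accelerationE_eq g hγ, hev.deriv.deriv_eq, hdd, map_add,
    IsIsometricAt.mapDeriv_christoffel h hiso, fderiv_chartMap_self h,
    velocityE_comp (h.mdifferentiableAt (by simp)) (hγ.mdifferentiableAt (by simp)),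
    ← velocityE_eq_deriv hγ]
  abel

end IsometricImages

/-! ### The geodesic equation and the curvature in `E`-valued terms -/

section Main

variable {E : Type*} [NormedAddCommGroup E] [NormedSpace ℝ E]
  {M : Type*} [TopologicalSpace M] [ChartedSpace E M] [IsManifold 𝓘(ℝ, E) ∞ M]

/-- With all vectors in the fixed space `E`, rewriting is not obstructed by the dependence of
tangent spaces on the base point. -/
theorem vectorialAlong_velocity_eq_zero_iff (g : Metric E M)
    (V : (x : M) → TangentSpace 𝓘(ℝ, E) x) (γ : ℝ → M) (t : ℝ) :
    vectorialAlong g V γ (velocity γ) t = 0 ↔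
      accelerationE g γ t + innerE g (γ t) (velocityE γ t) (velocityE γ t) • fieldE V (γ t) -
        innerE g (γ t) (fieldE V (γ t)) (velocityE γ t) • velocityE γ t = 0 := Iff.rfl

theorem firstCurvature_eq (g : Metric E M) (γ : ℝ → M) (t : ℝ) :
    firstCurvature g γ t =
      Real.sqrt (innerE g (γ t)
        (accelerationE g γ t - (innerE g (γ t) (accelerationE g γ t) (velocityE γ t) /
          innerE g (γ t) (velocityE γ t) (velocityE γ t)) • velocityE γ t)
        (accelerationE g γ t - (innerE g (γ t) (accelerationE g γ t) (velocityE γ t) /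
          innerE g (γ t) (velocityE γ t) (velocityE γ t)) • velocityE γ t)) /
      innerE g (γ t) (velocityE γ t) (velocityE γ t) := rfl

end Main

end VectorialTorsion

end

theorem mainTheorem5 {E : Type*} [NormedAddCommGroup E] [NormedSpace ℝ E] [FiniteDimensional ℝ E]
    {M : Type*} [TopologicalSpace M] [T2Space M] [ChartedSpace E M] [IsManifold 𝓘(ℝ, E) ∞ M]
    (g : VectorialTorsion.Metric E M)
    (V X : (x : M) → TangentSpace 𝓘(ℝ, E) x)
    (hV : VectorialTorsion.IsSmoothField V) (hX : VectorialTorsion.IsSmoothField X)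
    (hKilling : VectorialTorsion.IsKilling g X)
    (hcomm : ∀ x, VectorField.mlieBracket 𝓘(ℝ, E) X V x = 0)
    (s : ℝ) (γ : ℝ → M) (J : Set ℝ) (hJ : IsOpen J)
    (hdom : ∀ t ∈ J, γ t ∈ VectorialTorsion.flowDomain X s)
    (hγ : VectorialTorsion.IsGeodesicOn g V γ J) :
    VectorialTorsion.IsGeodesicOn g V (fun t => VectorialTorsion.flow X s (γ t)) J ∧
      ∀ t ∈ J, VectorialTorsion.velocity (E := E) γ t ≠ 0 →
        VectorialTorsion.velocity (E := E)
            (fun t => VectorialTorsion.flow X s (γ t)) t ≠ 0 ∧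
          VectorialTorsion.firstCurvature g (fun t => VectorialTorsion.flow X s (γ t)) t =
            VectorialTorsion.firstCurvature g γ t := by
  open VectorialTorsion in
  have : CompleteSpace E := FiniteDimensional.complete ℝ E
  -- The domain hypothesis holds only on the image of `γ`; regularity extends it to a neighbourhood,
  -- as differentiating `Φ_s` requires.
  have hreg : ∀ t ∈ J, FlowRegularAt X s (γ t) := fun t ht => by
    obtain ⟨q, a, b, c, h0, hs, hc, hc0, -⟩ := hdom t ht
    rw [← hc0]
    exact flowRegularAt_of_isMIntegralCurveOn hX hc h0 s hs
  have hγt : ∀ t ∈ J, ContMDiffAt 𝓘(ℝ, ℝ) 𝓘(ℝ, E) 2 γ t := fun t ht =>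
    hγ.1.contMDiffAt (hJ.mem_nhds ht)
  have hiso : ∀ t ∈ J, ∀ᶠ y in 𝓝 (γ t), IsIsometricAt g (flow X s) y := fun t ht =>
    (hreg t ht).1.mono fun y hy => hKilling.isIsometricAt_flow hX hy
  have hv : ∀ t ∈ J, velocityE (fun t => flow X s (γ t)) t =
      mapDeriv (flow X s) (γ t) (velocityE γ t) := fun t ht =>
    velocityE_comp ((hreg t ht).2.mdifferentiableAt (by simp))
      ((hγt t ht).mdifferentiableAt (by simp))
  have ha : ∀ t ∈ J, accelerationE g (fun t => flow X s (γ t)) t =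
      mapDeriv (flow X s) (γ t) (accelerationE g γ t) := fun t ht =>
    IsIsometricAt.accelerationE_comp (hreg t ht).2 (hiso t ht) (hγt t ht)
  refine ⟨⟨fun t ht => ((hreg t ht).2.comp t (hγt t ht)).contMDiffWithinAt, fun t ht => ?_⟩,
    fun t ht hne => ⟨fun h0 => hne ?_, ?_⟩⟩
  · have h1 := (vectorialAlong_velocity_eq_zero_iff g V γ t).1 (hγ.2 t ht)
    -- The scalar coefficients are unchanged by isometry, so the equation for the image curve is
    -- `dΦ_s` applied to the one for `γ`.
    rw [vectorialAlong_velocity_eq_zero_iff, hv t ht, ha t ht,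
      ← hKilling.mapDeriv_flow_field hX hV hcomm (hdom t ht), (hiso t ht).self_of_nhds,
      (hiso t ht).self_of_nhds, ← map_smul, ← map_smul, ← map_add, ← map_sub, h1, map_zero]
  · have h1 : mapDeriv (flow X s) (γ t) (velocityE γ t) = (0 : E) := (hv t ht).symm.trans h0
    have h2 : velocityE γ t = (0 : E) :=
      (hiso t ht).self_of_nhds.injective (h1.trans (map_zero _).symm)
    exact h2
  -- The projection coefficient is invariant, hence the normal acceleration of the image is `dΦ_s`
  -- of that of `γ` and has the same length.
  · rw [firstCurvature_eq, firstCurvature_eq, hv t ht, ha t ht, (hiso t ht).self_of_nhds,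
      (hiso t ht).self_of_nhds, ← map_smul, ← map_sub, (hiso t ht).self_of_nhds]
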